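/- Let $n\ge 2$, let $S^n$ be the unit sphere of $E^{n+1}=\mathbb R^{n+1}$ with its round metric $\gamma_{ij}$, Levi-Civita connection $\hat D_i$ and surface measure $d^n\Omega$, and let $\Omega^A$ ($A=1,\dots,n+1$) be the homogeneous Cartesian coordinates on $S^n$, $\Omega\cdot\Omega=1$. Vector fields are complex. A *(divergence-free) harmonic vector with eigenvalue $k_v^2$* is a smooth vector field $V$ on $S^n$ (the zero field being allowed) with $$(\hat D\cdot\hat D+k_v^2)V_i=0,\qquad \hat D^iV_i=0 .$$ For $\ell\ge1$ and a constant complex tensor $b=(b_{A_1\cdots A_\ell;B})$ on $E^{n+1}$ put $$V_b^i=b_{A_1\cdots A_\ell;B}\,\Omega^{A_1}\cdots\Omega^{A_\ell}\,\hat D^i\Omega^B ,$$ and consider the conditions (C1) $b_{A_1\cdots A_\ell;B}=b_{(A_1\cdots A_\ell);B}$; (C2) all traces over two of the first $\ell$ indices vanish, i.e. (given (C1)) $b_{A_1\cdots A_{\ell-2}C}{}^{C}{}_{;B}=0$ (no condition for $\ell=1$); (C3) $b_{(A_1\cdots A_\ell;A_{\ell+1})}=0$. Call $b$ *admissible* if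 it satisfies (C1), (C2) and (C3). Then the following hold. 1) Let $\ell\ge 1$ and $k_v^2=\ell(\ell+n-1)-1$. (a) A vector field $V$ on $S^n$ is a harmonic vector with eigenvalue $k_v^2$ if and only if $V=V_b$ for an admissible $b=(b_{A_1\cdots A_\ell;B})$; this $b$ is then unique. (b) If $b$ satisfies (C1) and (C2), and moreover $b_{A;}{}^{A}=0$ in the case $\ell=1$, then $V_b$ is a harmonic vector with eigenvalue $k_v^2$ if and only if (C3) holds. (c) If $b$ satisfies (C1) and (C3), then $V_b$ is a harmonic vector with eigenvalue $k_v^2$ if and only if (C2) holds. 2) The fields $V_b$ ($\ell\ge1$, $b$ admissible) are square integrable, and their complex linear span is dense in the $L^2$ space of divergence-free vector fields, i.e. the closed linear span of their classes is exactly the set of the square integrable vector fields $v$ on $S^n$ with $\int d^n\Omega\, v^i\hat D_i\varphi=0$ for all smooth functions $\varphi$. With $(V,W):=\int d^n\Omega\,\bar V_iW^i$, one has $(V_b,V_{b'})=0$ for admissible $b,b'$ with different values of $\ell$, and for admissible $b,b'$ with the same $\ell$ $$(V_b,V_{b'})=C(n,\ell)\,\bar b\cdot b',\qquad C(n,\ell)=\frac{2\pi^{\frac{n+1}{2}}\,\ell!}{2^\ell\,\Gamma\!\left(\frac{n+1}{2}+\ell\right)},$$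 where $\bar b\cdot b'=\sum\overline{b_{A_1\cdots A_\ell;B}}\,b'_{A_1\cdots A_\ell;B}$. 3) For $\ell\ge1$, the multiplicity of the $\ell$-th eigenvalue, i.e. the complex dimension of the space of harmonic vectors with eigenvalue $\ell(\ell+n-1)-1$, is $$N_V^\ell(S^n)=\frac{(n+2\ell-1)(n+\ell-1)(n+\ell-3)!}{(\ell+1)(\ell-1)!(n-2)!}.$$ -/

import Mathlib

open MeasureTheory Metric
open scoped Manifold ContDiff ComplexConjugate

noncomputable section

namespace HarmonicVectors

/-- The ambient Euclidean space `E^{n+1}`. -/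
abbrev Ambient (n : ℕ) : Type := EuclideanSpace ℝ (Fin (n + 1))

/-- The unit sphere `S^n` in `E^{n+1}`. -/
abbrev Sph (n : ℕ) : Type := sphere (0 : Ambient n) 1

/-- The values of the complex vector fields: vectors of `ℂ^{n+1}`. A (complex) tangent vector of the
sphere at `x` is identified with the vector `v` of `ℂ^{n+1}` with `∑ A, x^A v^A = 0`. -/
abbrev Vec (n : ℕ) : Type := EuclideanSpace ℂ (Fin (n + 1))

/-- The surface measure of the unit sphere. -/
def surfaceMeasure (n : ℕ) : Measure (Sph n) := (volume : Measure (Ambient n)).toSphere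

/-- The point `y / ‖y‖` of the sphere, for `y ≠ 0`. -/
def toSph {n : ℕ} (y : Ambient n) (hy : y ≠ 0) : Sph n :=
  ⟨‖y‖⁻¹ • y, by
    rw [mem_sphere_zero_iff_norm, norm_smul, norm_inv, norm_norm,
      inv_mul_cancel₀ (norm_ne_zero_iff.mpr hy)]⟩

open Classical in
/-- The extension of a function on the sphere to `E^{n+1} ∖ {0}` that is constant on rays
(with the value `0` at the origin). -/
def radialExt {n : ℕ} (f : Sph n → ℂ) (y : Ambient n) : ℂ :=
  if hy : y ≠ 0 then f (toSph y hy) else 0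

/-- `D_A f`, the `A`-th ambient component of the tangential differential of a function `f` on the
sphere. As the radial extension is constant on rays, its differential at a point `x` of the sphere
vanishes on the normal direction, and agrees with the differential of `f` on tangent vectors. -/
def tanD {n : ℕ} (A : Fin (n + 1)) (f : Sph n → ℂ) (x : Sph n) : ℂ :=
  fderiv ℝ (radialExt f) (x : Ambient n) (EuclideanSpace.single A (1 : ℝ))

/-- The matrix `δ_{AB} - x_A x_B` of the orthogonal projection onto the tangent space at `x`. -/
def tanProj {n : ℕ} (x : Sph n) (A B : Fin (n + 1)) : ℂ :=
  (if A = B then 1 else 0) - (((x : Ambient n) A : ℝ) : ℂ) * (((x : Ambient n) B : ℝ) : ℂ)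

/-- The homogeneous Cartesian coordinate `Ω^B` as a function on the sphere. -/
def coord {n : ℕ} (B : Fin (n + 1)) (x : Sph n) : ℂ := (((x : Ambient n) B : ℝ) : ℂ)

/-- `V` is tangent to the sphere at every point. -/
def IsTangent {n : ℕ} (V : Sph n → Vec n) : Prop := ∀ x, ∑ A, coord A x * V x A = 0

/-- The components `(D V)_{AB} = D_A V_B` of the covariant derivative (for the Levi-Civita connection
of the round metric) of a tangent vector field: the tangential projection of its ambient
derivative. -/
def covD {n : ℕ} (V : Sph n → Vec n) (A B : Fin (n + 1)) (x : Sph n) : ℂ :=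
  ∑ B', tanProj x B B' * tanD A (fun y => V y B') x

/-- The components `(D D V)_{ABC} = D_A D_B V_C` of the second covariant derivative: the covariant
derivative of the tensor field `D V`, which is its ambient derivative projected tangentially in all
slots. -/
def covD2 {n : ℕ} (V : Sph n → Vec n) (A B C : Fin (n + 1)) (x : Sph n) : ℂ :=
  ∑ B', ∑ C', tanProj x B B' * tanProj x C C' * tanD A (covD V B' C') x

/-- The divergence `D^i V_i`. The components are tangential, so that the ambient trace is the
trace over the tangent space. -/
def divergence {n : ℕ} (V : Sph n → Vec n) (x : Sph n) : ℂ := ∑ A, covD V A A x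

/-- The component `(D^i D_i V)_C` of the rough Laplacian `D · D V`. -/
def laplacian {n : ℕ} (V : Sph n → Vec n) (C : Fin (n + 1)) (x : Sph n) : ℂ :=
  ∑ A, covD2 V A A C x

/-- `V` is a (divergence-free) harmonic vector with eigenvalue `k2`: a smooth tangent vector field
with `(D · D + k2) V = 0` and `D^i V_i = 0`. The zero field is included. -/
structure IsHarmonicVector {n : ℕ} (k2 : ℝ) (V : Sph n → Vec n) : Prop where
  smooth : ContMDiff (𝓡 n) 𝓘(ℝ, Vec n) ∞ V
  tangent : IsTangent V
  eigen : ∀ x C, laplacian V C x + (k2 : ℂ) * V x C = 0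
  divFree : ∀ x, divergence V x = 0

/-! ### Constant tensors and the vector fields they define -/

/-- Constant complex tensors `b_{A_1 ⋯ A_ℓ ; B}` on `E^{n+1}`. -/
abbrev Tens (n ℓ : ℕ) : Type := (Fin ℓ → Fin (n + 1)) → Fin (n + 1) → ℂ

/-- `V_b^i = b_{A_1 ⋯ A_ℓ ; B} Ω^{A_1} ⋯ Ω^{A_ℓ} D^i Ω^B`. -/
def vecField {n ℓ : ℕ} (b : Tens n ℓ) (x : Sph n) : Vec n :=
  WithLp.toLp 2 fun i => ∑ A, ∑ B, b A B * (∏ k, coord (A k) x) * tanD i (coord B) x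

/-- `b_{A_1 ⋯ A_ℓ ; B} = b_{(A_1 ⋯ A_ℓ) ; B}`. -/
def IsSymm {n ℓ : ℕ} (b : Tens n ℓ) : Prop :=
  ∀ (σ : Equiv.Perm (Fin ℓ)) (A : Fin ℓ → Fin (n + 1)) (B : Fin (n + 1)), b (A ∘ σ) B = b A B

/-- Vanishing of the trace over any two of the first `ℓ` indices (no condition for `ℓ ≤ 1`). -/
def IsTraceless {n ℓ : ℕ} (b : Tens n ℓ) : Prop :=
  ∀ (j k : Fin ℓ), j ≠ k → ∀ (A : Fin ℓ → Fin (n + 1)) (B : Fin (n + 1)),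
    ∑ i, b (Function.update (Function.update A j i) k i) B = 0

/-- The full symmetrisation `b_{(A_1 ⋯ A_ℓ ; A_{ℓ+1})}`. -/
def fullSymm {n ℓ : ℕ} (b : Tens n ℓ) (A : Fin (ℓ + 1) → Fin (n + 1)) : ℂ :=
  (((ℓ + 1).factorial : ℂ))⁻¹ *
    ∑ σ : Equiv.Perm (Fin (ℓ + 1)), b (fun k => A (σ k.castSucc)) (A (σ (Fin.last ℓ)))

/-- `b` is symmetric and traceless in its first `ℓ` indices, with vanishing full symmetrisation. -/
structure IsAdmissible {n ℓ : ℕ} (b : Tens n ℓ) : Prop where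
  symm : IsSymm b
  traceless : IsTraceless b
  fullSymm_eq_zero : ∀ A, fullSymm b A = 0

/-- `k_v^2 = ℓ (ℓ + n - 1) - 1`. -/
def eigenvalue (n ℓ : ℕ) : ℝ := (ℓ : ℝ) * ((ℓ : ℝ) + n - 1) - 1

/-- `C(n,ℓ) = 2 π^{(n+1)/2} ℓ! / (2^ℓ Γ((n+1)/2 + ℓ))`. -/
def normConst (n ℓ : ℕ) : ℝ :=
  2 * Real.pi ^ (((n : ℝ) + 1) / 2) * (ℓ.factorial : ℝ) /
    (2 ^ ℓ * Real.Gamma (((n : ℝ) + 1) / 2 + ℓ))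

/-- `b̄ · b'`. -/
def tensDot {n ℓ : ℕ} (b b' : Tens n ℓ) : ℂ := ∑ A, ∑ B, conj (b A B) * b' A B

/-- `(V, W) = ∫ d^nΩ (V̄)_i W^i`. -/
def innerProd {n : ℕ} (V W : Sph n → Vec n) : ℂ :=
  ∫ x, ∑ A, conj (V x A) * W x A ∂(surfaceMeasure n)

/-! ### The `L²` space -/

/-- The Hilbert space of square integrable functions on the sphere with values in `ℂ^{n+1}`. -/
abbrev L2Vec (n : ℕ) : Type := Lp (Vec n) 2 (surfaceMeasure n)

/-- The square integrable vector fields on the sphere that are tangent almost everywhere and have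
vanishing divergence in the weak sense, `∫ v^i D_i φ = 0` for all smooth `φ`. -/
def l2DivFree (n : ℕ) : Set (L2Vec n) :=
  {v | (∀ᵐ x ∂(surfaceMeasure n), ∑ A, coord A x * v x A = 0) ∧
    ∀ φ : Sph n → ℂ, ContMDiff (𝓡 n) 𝓘(ℝ, ℂ) ∞ φ →
      ∫ x, ∑ A, v x A * tanD A φ x ∂(surfaceMeasure n) = 0}

/-- The classes in `L²` of the vector fields `V_b`, for all `ℓ ≥ 1` and all admissible `b`. -/
def l2VecFields (n : ℕ) : Set (L2Vec n) :=
  {v | ∃ ℓ : ℕ, 1 ≤ ℓ ∧ ∃ b : Tens n ℓ, IsAdmissible b ∧ v =ᵐ[surfaceMeasure n] vecField b}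

/-! ### The eigenspaces are complex vector spaces -/

/-- Smoothness of the radial extension away from the origin. -/
def SmoothExt {n : ℕ} (f : Sph n → ℂ) : Prop :=
  ∀ y : Ambient n, y ≠ 0 → ContDiffAt ℝ ∞ (radialExt f) y

theorem radialExt_coe {n : ℕ} (f : Sph n → ℂ) (x : Sph n) : radialExt f (x : Ambient n) = f x := by
  have h1 : ‖(x : Ambient n)‖ = 1 := norm_eq_of_mem_sphere x
  have h0 : (x : Ambient n) ≠ 0 := by
    intro h
    rw [h, norm_zero] at h1
    exact zero_ne_one h1
  have h2 : toSph (x : Ambient n) h0 = x := by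
    apply Subtype.ext
    simp [toSph, h1]
  rw [radialExt, dif_pos h0, h2]

theorem coe_ne_zero {n : ℕ} (x : Sph n) : (x : Ambient n) ≠ 0 := by
  intro h
  have h1 : ‖(x : Ambient n)‖ = 1 := norm_eq_of_mem_sphere x
  rw [h, norm_zero] at h1
  exact zero_ne_one h1

theorem contDiffAt_toSph {n : ℕ} (y : Ambient n) (hy : y ≠ 0) :
    ContDiffAt ℝ ∞ (fun z : Ambient n => ‖z‖⁻¹ • z) y :=
  ((contDiffAt_norm ℝ hy).inv (norm_ne_zero_iff.mpr hy)).smul contDiffAt_id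

theorem radialExt_eventuallyEq {n : ℕ} (f : Sph n → ℂ) (g : Ambient n → ℂ)
    (h : ∀ x : Sph n, f x = g x) (y : Ambient n) (hy : y ≠ 0) :
    radialExt f =ᶠ[nhds y] fun z => g (‖z‖⁻¹ • z) := by
  filter_upwards [isOpen_ne.mem_nhds hy] with z hz
  rw [radialExt, dif_pos hz, h]
  rfl

theorem smoothExt_of_ambient {n : ℕ} (f : Sph n → ℂ) (g : Ambient n → ℂ)
    (h : ∀ x : Sph n, f x = g x) (hg : ∀ x : Sph n, ContDiffAt ℝ ∞ g x) : SmoothExt f := by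
  intro y hy
  refine ContDiffAt.congr_of_eventuallyEq ?_ (radialExt_eventuallyEq f g h y hy)
  exact (hg (toSph y hy)).comp y (contDiffAt_toSph y hy)

theorem smoothExt_of_contMDiff {n : ℕ} {f : Sph n → ℂ} (hf : ContMDiff (𝓡 n) 𝓘(ℝ, ℂ) ∞ f) :
    SmoothExt f := by
  intro y hy
  have := Fact.mk (@finrank_euclideanSpace_fin ℝ _ (n + 1))
  let U : TopologicalSpace.Opens (Ambient n) := ⟨{z | z ≠ 0}, isOpen_ne⟩
  have h1 : ContMDiff 𝓘(ℝ, Ambient n) 𝓘(ℝ, Ambient n) ∞ (fun z : U => ‖(z : Ambient n)‖⁻¹ • (z : Ambient n)) := by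
    intro z
    rw [contMDiffAt_subtype_iff (f := fun w : Ambient n => ‖w‖⁻¹ • w)]
    exact (contDiffAt_toSph (z : Ambient n) z.2).contMDiffAt
  have h2 : ContMDiff 𝓘(ℝ, Ambient n) (𝓡 n) ∞ (fun z : U => toSph (z : Ambient n) z.2) :=
    ContMDiff.codRestrict_sphere h1 (fun z => (toSph (z : Ambient n) z.2).2)
  have h3 : ContMDiffAt 𝓘(ℝ, Ambient n) 𝓘(ℝ, ℂ) ∞ (fun z : U => radialExt f z) ⟨y, hy⟩ := by
    have h4 := (hf.comp h2) ⟨y, hy⟩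
    refine h4.congr_of_eventuallyEq (Filter.Eventually.of_forall fun z => ?_)
    exact dif_pos z.2
  exact (contMDiffAt_subtype_iff.mp h3).contDiffAt

theorem SmoothExt.tanD {n : ℕ} {f : Sph n → ℂ} (hf : SmoothExt f) (A : Fin (n + 1)) :
    SmoothExt (tanD A f) := by
  refine smoothExt_of_ambient _
    (fun z => fderiv ℝ (radialExt f) z (EuclideanSpace.single A (1 : ℝ))) (fun _ => rfl) ?_
  intro x
  exact ((hf x (coe_ne_zero x)).fderiv_right (m := ∞) le_rfl).clm_apply contDiffAt_const

theorem SmoothExt.add {n : ℕ} {f g : Sph n → ℂ} (hf : SmoothExt f) (hg : SmoothExt g) :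
    SmoothExt (fun x => f x + g x) :=
  smoothExt_of_ambient _ (fun z => radialExt f z + radialExt g z)
    (fun x => by simp only [radialExt_coe])
    (fun x => (hf x (coe_ne_zero x)).add (hg x (coe_ne_zero x)))

theorem SmoothExt.mul {n : ℕ} {f g : Sph n → ℂ} (hf : SmoothExt f) (hg : SmoothExt g) :
    SmoothExt (fun x => f x * g x) :=
  smoothExt_of_ambient _ (fun z => radialExt f z * radialExt g z)
    (fun x => by simp only [radialExt_coe])
    (fun x => (hf x (coe_ne_zero x)).mul (hg x (coe_ne_zero x)))

theorem smoothExt_const {n : ℕ} (c : ℂ) : SmoothExt (fun _ : Sph n => c) :=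
  smoothExt_of_ambient _ (fun _ => c) (fun _ => rfl) (fun _ => contDiffAt_const)

theorem smoothExt_sum {n : ℕ} {ι : Type*} (s : Finset ι) (f : ι → Sph n → ℂ)
    (hf : ∀ i, SmoothExt (f i)) : SmoothExt (fun x => ∑ i ∈ s, f i x) :=
  smoothExt_of_ambient _ (fun z => ∑ i ∈ s, radialExt (f i) z)
    (fun x => by simp only [radialExt_coe])
    (fun x => ContDiffAt.sum fun i _ => hf i x (coe_ne_zero x))

theorem smoothExt_coord {n : ℕ} (B : Fin (n + 1)) : SmoothExt (coord (n := n) B) :=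
  smoothExt_of_ambient _ (fun z : Ambient n => ((z B : ℝ) : ℂ)) (fun _ => rfl)
    (fun _ => (Complex.ofRealCLM.contDiff.comp
      (EuclideanSpace.proj (𝕜 := ℝ) B).contDiff).contDiffAt)

theorem smoothExt_tanProj {n : ℕ} (A B : Fin (n + 1)) :
    SmoothExt (fun x : Sph n => tanProj x A B) := by
  have h := (smoothExt_const (n := n) (if A = B then 1 else 0)).add
    ((smoothExt_const (-1)).mul ((smoothExt_coord A).mul (smoothExt_coord B)))
  convert h using 2
  simp only [tanProj, coord]
  ring

theorem tanD_add {n : ℕ} {f g : Sph n → ℂ} (hf : SmoothExt f) (hg : SmoothExt g)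
    (A : Fin (n + 1)) (x : Sph n) :
    tanD A (fun y => f y + g y) x = tanD A f x + tanD A g x := by
  have h : radialExt (fun y => f y + g y) = radialExt f + radialExt g := by
    funext y
    by_cases hy : y ≠ 0 <;> simp [radialExt, hy]
  have h1 := (hf x (coe_ne_zero x)).differentiableAt (by simp)
  have h2 := (hg x (coe_ne_zero x)).differentiableAt (by simp)
  rw [tanD, h, fderiv_add h1 h2]
  rfl

theorem tanD_const_mul {n : ℕ} {f : Sph n → ℂ} (hf : SmoothExt f) (c : ℂ)
    (A : Fin (n + 1)) (x : Sph n) :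
    tanD A (fun y => c * f y) x = c * tanD A f x := by
  have h : radialExt (fun y => c * f y) = fun y => c * radialExt f y := by
    funext y
    by_cases hy : y ≠ 0 <;> simp [radialExt, hy]
  have h1 := (hf x (coe_ne_zero x)).differentiableAt (by simp)
  rw [tanD, h, fderiv_const_mul h1]
  rfl

theorem IsHarmonicVector.smoothExt {n : ℕ} {k2 : ℝ} {V : Sph n → Vec n}
    (hV : IsHarmonicVector k2 V) (B : Fin (n + 1)) : SmoothExt (fun y => V y B) := by
  apply smoothExt_of_contMDiff
  exact (((EuclideanSpace.proj (𝕜 := ℂ) B).restrictScalars ℝ).contMDiff).comp hV.smooth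

theorem IsHarmonicVector.smoothExt_covD {n : ℕ} {k2 : ℝ} {V : Sph n → Vec n}
    (hV : IsHarmonicVector k2 V) (A B : Fin (n + 1)) : SmoothExt (covD V A B) :=
  smoothExt_sum _ (fun B' x => tanProj x B B' * tanD A (fun y => V y B') x)
    (fun B' => (smoothExt_tanProj B B').mul ((hV.smoothExt B').tanD A))

theorem covD_add {n : ℕ} {k2 : ℝ} {V W : Sph n → Vec n} (hV : IsHarmonicVector k2 V)
    (hW : IsHarmonicVector k2 W) (A B : Fin (n + 1)) :
    covD (V + W) A B = fun x => covD V A B x + covD W A B x := by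
  funext x
  simp only [covD, ← Finset.sum_add_distrib, ← mul_add]
  refine Finset.sum_congr rfl fun B' _ => ?_
  rw [← tanD_add (hV.smoothExt B') (hW.smoothExt B')]
  rfl

theorem covD_smul {n : ℕ} {k2 : ℝ} {V : Sph n → Vec n} (hV : IsHarmonicVector k2 V) (c : ℂ)
    (A B : Fin (n + 1)) : covD (c • V) A B = fun x => c * covD V A B x := by
  funext x
  simp only [covD, Finset.mul_sum]
  refine Finset.sum_congr rfl fun B' _ => ?_
  rw [mul_left_comm, ← tanD_const_mul (hV.smoothExt B')]
  rfl

theorem IsHarmonicVector.zero {n : ℕ} (k2 : ℝ) : IsHarmonicVector k2 (0 : Sph n → Vec n) := by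
  have h0 : ∀ (A : Fin (n + 1)) (x : Sph n), tanD A (fun _ => (0 : ℂ)) x = 0 := by
    intro A x
    have h : radialExt (fun _ : Sph n => (0 : ℂ)) = fun _ => 0 := by
      funext y
      simp [radialExt]
    rw [tanD, h]
    simp
  have h1 : ∀ A B : Fin (n + 1), covD (0 : Sph n → Vec n) A B = fun _ => 0 := by
    intro A B
    funext x
    simp [covD, h0]
  refine ⟨contMDiff_const, fun x => by simp, fun x C => ?_, fun x => ?_⟩
  · simp [laplacian, covD2, h1, h0]
  · simp [divergence, h1]

theorem IsHarmonicVector.add {n : ℕ} {k2 : ℝ} {V W : Sph n → Vec n}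
    (hV : IsHarmonicVector k2 V) (hW : IsHarmonicVector k2 W) : IsHarmonicVector k2 (V + W) := by
  refine ⟨hV.smooth.add hW.smooth, fun x => ?_, fun x C => ?_, fun x => ?_⟩
  · have h := congrArg₂ (· + ·) (hV.tangent x) (hW.tangent x)
    simpa [mul_add, Finset.sum_add_distrib] using h
  · have h := congrArg₂ (· + ·) (hV.eigen x C) (hW.eigen x C)
    have e : laplacian (V + W) C x = laplacian V C x + laplacian W C x := by
      simp only [laplacian, covD2, ← Finset.sum_add_distrib, ← mul_add]
      refine Finset.sum_congr rfl fun A _ => Finset.sum_congr rfl fun B' _ =>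
        Finset.sum_congr rfl fun C' _ => ?_
      rw [covD_add hV hW, tanD_add (hV.smoothExt_covD B' C') (hW.smoothExt_covD B' C')]
    have e2 : (V + W) x C = V x C + W x C := rfl
    rw [e, e2]
    linear_combination hV.eigen x C + hW.eigen x C
  · simp only [divergence, covD_add hV hW, Finset.sum_add_distrib]
    have h1 := hV.divFree x
    have h2 := hW.divFree x
    simp only [divergence] at h1 h2
    rw [h1, h2, add_zero]

theorem IsHarmonicVector.smul {n : ℕ} {k2 : ℝ} {V : Sph n → Vec n}
    (hV : IsHarmonicVector k2 V) (c : ℂ) : IsHarmonicVector k2 (c • V) := by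
  refine ⟨?_, fun x => ?_, fun x C => ?_, fun x => ?_⟩
  · exact (((c • ContinuousLinearMap.id ℂ (Vec n)).restrictScalars ℝ).contMDiff).comp hV.smooth
  · have h : ∑ A, coord A x * (c • V) x A = c * ∑ A, coord A x * V x A := by
      rw [Finset.mul_sum]
      refine Finset.sum_congr rfl fun A _ => ?_
      rw [mul_left_comm]
      rfl
    rw [h, hV.tangent x, mul_zero]
  · have e : laplacian (c • V) C x = c * laplacian V C x := by
      simp only [laplacian, covD2, Finset.mul_sum]
      refine Finset.sum_congr rfl fun A _ => Finset.sum_congr rfl fun B' _ =>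
        Finset.sum_congr rfl fun C' _ => ?_
      rw [covD_smul hV, tanD_const_mul (hV.smoothExt_covD B' C')]
      ring
    have e2 : (c • V) x C = c * V x C := rfl
    rw [e, e2]
    linear_combination c * hV.eigen x C
  · have h1 := hV.divFree x
    simp only [divergence] at h1
    simp only [divergence, covD_smul hV, ← Finset.mul_sum, h1, mul_zero]

/-- The eigenspace: the complex vector space of all harmonic vectors with eigenvalue `k2`. -/
def harmonicSpace (n : ℕ) (k2 : ℝ) : Submodule ℂ (Sph n → Vec n) where
  carrier := {V | IsHarmonicVector k2 V}
  add_mem' hV hW := hV.add hW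
  zero_mem' := IsHarmonicVector.zero k2
  smul_mem' c _ hV := hV.smul c

end HarmonicVectors

end

open HarmonicVectors

/-!
# Harmonic vectors on the sphere

Everything is reduced to polynomials on the ambient space. A symmetric tensor with `ℓ` indices is the
same as a homogeneous polynomial of degree `ℓ` (`pderiv_tensPoly`, `eq_zero_of_tensPoly`,
`exists_tensPoly_eq`), and under this dictionary `b` is admissible exactly when the polynomial vector
field `u_B = b_{A_1 ⋯ A_ℓ ; B} X^{A_1} ⋯ X^{A_ℓ}` has harmonic components and satisfies `X · u = 0`
(`isAdmissible_iff`). The space of these `u` is `tangHarm`.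

For a tangent field the rough Laplacian is `Δ_S V_C + V_C + 2 x_C div V` in Cartesian components
(`laplacian_eq`), and on homogeneous polynomials of degree `ℓ` the sphere Laplacian `Δ_S` is the
ambient Laplacian minus `ℓ (ℓ + n - 1)` (`sphLap_evalAt`). Hence elements of `tangHarm` restrict to
harmonic vectors. Conversely the components of a harmonic vector are smooth eigenfunctions of `Δ_S`,
and such eigenfunctions are spherical harmonics (`exists_harmPoly_of_sphLap`): `Δ_S` is symmetric by
the divergence theorem on the sphere (`integral_tanD`, obtained in polar coordinates from
`∫ ∂_A F = 0` in the ambient space), and the spherical harmonics are complete by the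
Stone–Weierstrass theorem (`ae_eq_zero_of_orthogonal_harmPoly`).

The algebra rests on the bijectivity of `p ↦ Δ(r² p)` on homogeneous polynomials
(`exists_lap_rsq_mul_eq`). It yields the decomposition of polynomials into `r²`-multiples of harmonic
ones, the dimensions, and the splitting of a harmonic vector polynomial into an element of `tangHarm`
and terms that on the sphere are gradients or normal fields (`exists_tangHarm_decomposition`). Those
terms are orthogonal to divergence-free tangent fields, whence the completeness of the `V_b`.
The inner products come from repeated integration by parts (`sum_integral_pderiv_mul_pderiv`), each
step of which removes one index from both tensors.
-/

noncomputable section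

namespace HarmonicVectors

open MvPolynomial

/-! ### Harmonic homogeneous polynomials -/

/-- Complex polynomials on the ambient space `E^{n+1}`. -/
abbrev Poly (n : ℕ) : Type := MvPolynomial (Fin (n + 1)) ℂ

/-- The ambient Laplacian `∑ A, ∂_A ∂_A` on polynomials. -/
def lap (n : ℕ) : Poly n →ₗ[ℂ] Poly n :=
  ∑ A, (pderiv A).toLinearMap ∘ₗ (pderiv A).toLinearMap

/-- The squared radius `∑ A, X_A²`. -/
def rsq (n : ℕ) : Poly n := ∑ A, X A ^ 2

/-- The Euler operator `∑ A, X_A ∂_A`, which multiplies polynomials of degree `k` by `k`. -/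
def euler {n : ℕ} (p : Poly n) : Poly n := ∑ A, X A * pderiv A p

variable {n : ℕ}

theorem lap_apply (p : Poly n) : lap n p = ∑ A, pderiv A (pderiv A p) := by
  simp [lap]

theorem pderiv_comm (A B : Fin (n + 1)) (p : Poly n) :
    pderiv A (pderiv B p) = pderiv B (pderiv A p) := by
  have h : ⁅(pderiv A : Derivation ℂ (Poly n) (Poly n)),
      (pderiv B : Derivation ℂ (Poly n) (Poly n))⁆ = 0 := by
    apply MvPolynomial.derivation_ext
    intro i
    classical
    simp [Derivation.commutator_apply, pderiv_X, Pi.single_apply, apply_ite]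
  have := congrArg (fun D : Derivation ℂ (Poly n) (Poly n) => D p) h
  simpa [Derivation.commutator_apply, sub_eq_zero] using this

theorem lap_pderiv (A : Fin (n + 1)) (p : Poly n) : lap n (pderiv A p) = pderiv A (lap n p) := by
  simp only [lap_apply, map_sum]
  refine Finset.sum_congr rfl fun B _ => ?_
  rw [pderiv_comm B A p, pderiv_comm B A]

theorem lap_X_mul (A : Fin (n + 1)) (p : Poly n) :
    lap n (X A * p) = 2 * pderiv A p + X A * lap n p := by
  classical
  have h : ∀ B, pderiv B (pderiv B (X A * p)) =
      2 * ((if B = A then 1 else 0) * pderiv B p) + X A * pderiv B (pderiv B p) := by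
    intro B
    by_cases hB : B = A
    · subst hB
      simp [Derivation.leibniz, smul_eq_mul]
      ring
    · simp [Derivation.leibniz, smul_eq_mul, pderiv_X, Ne.symm hB, hB]
  simp only [lap_apply, h, Finset.sum_add_distrib, ← Finset.mul_sum]
  simp

theorem lap_sum_X_mul (u : Fin (n + 1) → Poly n) :
    lap n (∑ A, X A * u A) = 2 * ∑ A, pderiv A (u A) + ∑ A, X A * lap n (u A) := by
  simp only [map_sum, lap_X_mul, Finset.sum_add_distrib, Finset.mul_sum]

theorem lap_rsq_mul (p : Poly n) :
    lap n (rsq n * p) = (2 * (n + 1) : ℂ) • p + (4 : ℂ) • euler p + rsq n * lap n p := by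
  have h : rsq n * p = ∑ A, X A * (X A * p) := by
    rw [rsq, Finset.sum_mul]
    exact Finset.sum_congr rfl fun A _ => by ring
  have h2 : rsq n * lap n p = ∑ A, X A * (X A * lap n p) := by
    rw [rsq, Finset.sum_mul]
    exact Finset.sum_congr rfl fun A _ => by ring
  rw [h, h2, lap_sum_X_mul]
  simp only [lap_X_mul, Derivation.leibniz, smul_eq_mul, pderiv_X_self, mul_add,
    Finset.sum_add_distrib, euler]
  simp only [mul_one, Finset.sum_const, Finset.card_univ, Fintype.card_fin, nsmul_eq_mul,
    smul_eq_C_mul, map_mul, map_add, map_natCast, map_ofNat, Finset.mul_sum]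
  push_cast
  have : ∑ i, X i * (2 * pderiv i p) = ∑ i, 2 * (X i * pderiv i p) :=
    Finset.sum_congr rfl fun i _ => by ring
  rw [this]
  simp only [← Finset.mul_sum]
  ring

theorem euler_of_isHomogeneous {k : ℕ} {p : Poly n} (hp : p.IsHomogeneous k) :
    euler p = (k : ℂ) • p := by
  rw [euler, hp.sum_X_mul_pderiv, Nat.cast_smul_eq_nsmul]

theorem euler_pderiv {k : ℕ} {p : Poly n} (hp : p.IsHomogeneous k) (A : Fin (n + 1)) :
    euler (pderiv A p) = ((k : ℂ) - 1) • pderiv A p := by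
  classical
  have h := congrArg (pderiv A) (euler_of_isHomogeneous hp)
  simp only [euler, map_sum, Derivation.leibniz, smul_eq_mul, Finset.sum_add_distrib,
    pderiv_X, Pi.single_apply, Derivation.map_smul] at h
  simp only [pderiv_comm A] at h
  rw [sub_smul, ← h, euler]
  simp

theorem isHomogeneous_rsq : (rsq n).IsHomogeneous 2 :=
  IsHomogeneous.sum _ _ _ fun A _ => by simpa using (isHomogeneous_X ℂ A).pow 2

theorem isHomogeneous_pderiv {k : ℕ} {p : Poly n} (hp : p.IsHomogeneous (k + 1))
    (A : Fin (n + 1)) : (pderiv A p).IsHomogeneous k := hp.pderiv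

/-- For `k ≤ 1` the truncated degree is harmless, as the Laplacian then vanishes. -/
theorem isHomogeneous_lap {k : ℕ} {p : Poly n} (hp : p.IsHomogeneous k) :
    (lap n p).IsHomogeneous (k - 1 - 1) := by
  rw [lap_apply]
  exact IsHomogeneous.sum _ _ _ fun A _ => hp.pderiv.pderiv

/-- Applying the Laplacian to the equation yields the same equation for `lap n p`, of degree `k - 2`
and with a larger constant, so that induction on the degree applies. -/
theorem eq_zero_of_smul_add_rsq_mul_lap (k : ℕ) : ∀ (c : ℕ) (_ : 0 < c) (p : Poly n),
    p.IsHomogeneous k → (c : ℂ) • p + rsq n * lap n p = 0 → p = 0 := by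
  induction k using Nat.strong_induction_on with
  | _ k ih =>
    intro c hc p hp h
    have hc' : (c : ℂ) ≠ 0 := by exact_mod_cast hc.ne'
    have hq : lap n p = 0 := by
      rcases Nat.eq_zero_or_pos k with rfl | hk
      · rw [← totalDegree_zero_iff_isHomogeneous, totalDegree_eq_zero_iff_eq_C] at hp
        rw [hp, lap_apply]
        simp
      · have hh := isHomogeneous_lap hp
        refine ih (k - 1 - 1) (by omega) (c + 2 * (n + 1) + 4 * (k - 1 - 1)) (by omega) _ hh ?_
        have h2 := congrArg (lap n) h
        rw [map_add, map_smul, lap_rsq_mul, euler_of_isHomogeneous hh, map_zero] at h2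
        rw [← h2]
        push_cast
        module
    simpa [hq, hc'] using h

instance (k : ℕ) : FiniteDimensional ℂ (homogeneousSubmodule (Fin (n + 1)) ℂ k) :=
  Module.Finite.iff_fg.mpr (homogeneousSubmodule_fg _ _ k)

/-- By the injectivity in `eq_zero_of_smul_add_rsq_mul_lap`, the map `p ↦ lap (rsq * p)` is a
bijection of the finite-dimensional space of homogeneous polynomials of degree `k`. -/
theorem exists_lap_rsq_mul_eq {k : ℕ} {f : Poly n} (hf : f.IsHomogeneous k) :
    ∃ p : Poly n, p.IsHomogeneous k ∧ lap n (rsq n * p) = f := by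
  have hmaps : ∀ p ∈ homogeneousSubmodule (Fin (n + 1)) ℂ k,
      (lap n ∘ₗ LinearMap.mulLeft ℂ (rsq n)) p ∈ homogeneousSubmodule (Fin (n + 1)) ℂ k := by
    intro p hp
    have := isHomogeneous_lap (isHomogeneous_rsq.mul hp)
    rwa [show 2 + k - 1 - 1 = k by omega] at this
  let L := (lap n ∘ₗ LinearMap.mulLeft ℂ (rsq n)).restrict hmaps
  have hinj : Function.Injective L := by
    rw [← LinearMap.ker_eq_bot, LinearMap.ker_eq_bot']
    rintro ⟨p, hp⟩ h
    have h' : lap n (rsq n * p) = 0 := congrArg Subtype.val h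
    rw [lap_rsq_mul, euler_of_isHomogeneous hp] at h'
    apply Subtype.ext
    refine eq_zero_of_smul_add_rsq_mul_lap k (2 * (n + 1) + 4 * k) (by omega) p hp ?_
    rw [← h']
    push_cast
    module
  obtain ⟨⟨p, hp⟩, h⟩ := LinearMap.injective_iff_surjective.mp hinj ⟨f, hf⟩
  exact ⟨p, hp, congrArg Subtype.val h⟩

/-- The space of harmonic homogeneous polynomials of degree `k`. -/
def harmPoly (n k : ℕ) : Submodule ℂ (Poly n) :=
  homogeneousSubmodule (Fin (n + 1)) ℂ k ⊓ LinearMap.ker (lap n)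

theorem mem_harmPoly {k : ℕ} {p : Poly n} :
    p ∈ harmPoly n k ↔ p.IsHomogeneous k ∧ lap n p = 0 := Iff.rfl

theorem harmPoly_pderiv {k : ℕ} {p : Poly n} (hp : p ∈ harmPoly n (k + 1)) (A : Fin (n + 1)) :
    pderiv A p ∈ harmPoly n k :=
  ⟨isHomogeneous_pderiv hp.1 A, by
    change lap n _ = 0
    rw [lap_pderiv, (mem_harmPoly.mp hp).2, map_zero]⟩

theorem exists_sub_rsq_mul_mem_harmPoly {k : ℕ} {f : Poly n} (hf : f.IsHomogeneous (k + 2)) :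
    ∃ p : Poly n, p.IsHomogeneous k ∧ f - rsq n * p ∈ harmPoly n (k + 2) := by
  obtain ⟨p, hp, h⟩ := exists_lap_rsq_mul_eq (isHomogeneous_lap hf)
  refine ⟨p, hp, ?_, ?_⟩
  · have := isHomogeneous_rsq.mul hp
    exact hf.sub (by rwa [show 2 + (k + 2 - 1 - 1) = k + 2 by omega] at this)
  · change lap n _ = 0
    rw [map_sub, h, sub_self]

instance (k : ℕ) : FiniteDimensional ℂ (harmPoly n k) :=
  Submodule.finiteDimensional_of_le inf_le_left

/-! ### Tangent and radial polynomial vector fields -/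

theorem sum_X_mul_gradient_add_radial (S h g : Poly n) :
    ∑ B, X B * (pderiv B S + X B * h + rsq n * pderiv B g) =
      euler S + rsq n * h + rsq n * euler g := by
  simp only [mul_add, Finset.sum_add_distrib, euler]
  congr 1
  · congr 1
    rw [rsq, Finset.sum_mul]
    exact Finset.sum_congr rfl fun B _ => by ring
  · rw [Finset.mul_sum]
    exact Finset.sum_congr rfl fun B _ => by ring

theorem isHomogeneous_rsq_mul_pderiv {k : ℕ} {h : Poly n} (hh : h.IsHomogeneous k)
    (B : Fin (n + 1)) : (rsq n * pderiv B h).IsHomogeneous (k + 1) := by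
  rcases Nat.eq_zero_or_pos k with rfl | hk
  · rw [← totalDegree_zero_iff_isHomogeneous, totalDegree_eq_zero_iff_eq_C] at hh
    rw [hh, pderiv_C, mul_zero]
    exact isHomogeneous_zero _ _ _
  · have := isHomogeneous_rsq.mul (hh.pderiv (i := B))
    rwa [show 2 + (k - 1) = k + 1 by omega] at this

theorem isHomogeneous_smul {k : ℕ} {p : Poly n} (c : ℂ) (hp : p.IsHomogeneous k) :
    (c • p).IsHomogeneous k :=
  (homogeneousSubmodule _ _ _).smul_mem c hp

/-- For a biharmonic `s` of degree `k + 2` the decomposition `s = S + r² h` into harmonic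
parts is explicit, with `h` a multiple of `lap s`. -/
theorem exists_eq_add_rsq_mul {k : ℕ} {s : Poly n}
    (hs : s.IsHomogeneous (k + 2)) (hh : lap n (lap n s) = 0) :
    ∃ S ∈ harmPoly n (k + 2), ∃ h ∈ harmPoly n k, s = S + rsq n * h := by
  have e1 : (2 * ((n : ℂ) + 1) + 4 * k) ≠ 0 := by
    have : (2 * ((n : ℝ) + 1) + 4 * k) ≠ 0 := by positivity
    exact_mod_cast this
  have hhom : (lap n s).IsHomogeneous k := isHomogeneous_lap hs
  have h1 := isHomogeneous_smul (2 * ((n : ℂ) + 1) + 4 * k)⁻¹ hhom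
  have h2 : lap n ((2 * ((n : ℂ) + 1) + 4 * k)⁻¹ • lap n s) = 0 := by rw [map_smul, hh, smul_zero]
  refine ⟨s - rsq n * ((2 * ((n : ℂ) + 1) + 4 * k)⁻¹ • lap n s), ⟨hs.sub ?_, ?_⟩, _, ⟨h1, h2⟩,
    by ring⟩
  · have := isHomogeneous_rsq.mul h1
    rwa [add_comm 2 k] at this
  · change lap n _ = 0
    rw [map_sub, lap_rsq_mul, euler_of_isHomogeneous h1, h2, mul_zero, add_zero, smul_smul,
      smul_smul, smul_smul, ← add_smul, ← add_mul, mul_inv_cancel₀ e1, one_smul,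
      sub_self]

/-- A vector field with harmonic components of degree `k + 1` and prescribed biharmonic radial
component `s`, built from gradients and radial fields only. -/
theorem exists_gradient_add_radial (hn : 2 ≤ n) {k : ℕ} {s : Poly n}
    (hs : s.IsHomogeneous (k + 2)) (hss : lap n (lap n s) = 0) :
    ∃ S h g : Poly n,
      (∀ B, pderiv B S + X B * h + rsq n * pderiv B g ∈ harmPoly n (k + 1)) ∧
      ∑ B, X B * (pderiv B S + X B * h + rsq n * pderiv B g) = s := by
  have hn' : (2 : ℝ) ≤ n := by exact_mod_cast hn
  have hk' : (0 : ℝ) ≤ k := by positivity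
  have e2 : ((n : ℂ) - 1 + 2 * k) ≠ 0 := by
    have : ((n : ℝ) - 1 + 2 * k) ≠ 0 := by linarith
    exact_mod_cast this
  have e3 : ((n : ℂ) - 1 + k) ≠ 0 := by
    have : ((n : ℝ) - 1 + k) ≠ 0 := by linarith
    exact_mod_cast this
  have e4 : ((k : ℂ) + 2) ≠ 0 := by
    have : ((k : ℝ) + 2) ≠ 0 := by positivity
    exact_mod_cast this
  obtain ⟨S, hS, h, hh, rfl⟩ := exists_eq_add_rsq_mul hs hss
  -- `X_B h - γ r² ∂_B h` is harmonic for this `γ`, and `β` normalises its radial component.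
  obtain ⟨β, γ, h1, h2⟩ : ∃ β γ : ℂ, β * 2 - γ * (2 * (n + 1) + 4 * (k - 1)) = 0 ∧
      β - γ * k = 1 := by
    refine ⟨((n : ℂ) - 1 + 2 * k) / ((n : ℂ) - 1 + k), 1 / ((n : ℂ) - 1 + k), ?_, ?_⟩ <;>
    · field_simp
      ring
  refine ⟨((k : ℂ) + 2)⁻¹ • S, β • h, (-γ) • h, fun B => ⟨?_, ?_⟩, ?_⟩
  · refine ((IsHomogeneous.add ?_ ?_).add ?_)
    · exact isHomogeneous_pderiv (isHomogeneous_smul _ hS.1) B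
    · rw [add_comm k 1]
      exact (isHomogeneous_X ℂ B).mul (isHomogeneous_smul _ hh.1)
    · exact isHomogeneous_rsq_mul_pderiv (isHomogeneous_smul _ hh.1) B
  · change lap n _ = 0
    simp only [Derivation.map_smul, mul_smul_comm, map_add, map_smul, lap_pderiv,
      (mem_harmPoly.mp hS).2, map_zero, lap_X_mul, (mem_harmPoly.mp hh).2, lap_rsq_mul,
      euler_pderiv hh.1, mul_zero, smul_zero, zero_add, add_zero]
    rw [show (2 : Poly n) * pderiv B h = (2 : ℂ) • pderiv B h by rw [smul_eq_C_mul, map_ofNat],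
      smul_smul, smul_smul, ← add_smul, smul_smul, ← add_smul]
    rw [show β * 2 + -γ * (2 * (↑n + 1) + 4 * (↑k - 1)) = 0 by rw [← h1]; ring, zero_smul]
  · rw [sum_X_mul_gradient_add_radial, euler_of_isHomogeneous (isHomogeneous_smul _ hS.1),
      euler_of_isHomogeneous (isHomogeneous_smul _ hh.1), smul_smul, mul_smul_comm, mul_smul_comm,
      mul_smul_comm, smul_smul, add_assoc, ← add_smul,
      show ((k + 2 : ℕ) : ℂ) * ((k : ℂ) + 2)⁻¹ = 1 by push_cast; exact mul_inv_cancel₀ e4,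
      show β + k * -γ = 1 by rw [← h2]; ring, one_smul, one_smul]

/-- The polynomial vector fields that are tangent to all spheres around the origin and have
harmonic components of degree `k`. -/
def tangHarm (n k : ℕ) : Submodule ℂ (Fin (n + 1) → Poly n) where
  carrier := {u | (∀ B, u B ∈ harmPoly n k) ∧ ∑ B, X B * u B = 0}
  add_mem' hu hv := ⟨fun B => (harmPoly n k).add_mem (hu.1 B) (hv.1 B), by
    simp [mul_add, Finset.sum_add_distrib, hu.2, hv.2]⟩
  zero_mem' := ⟨fun _ => (harmPoly n k).zero_mem, by simp⟩
  smul_mem' c u hu := ⟨fun B => (harmPoly n k).smul_mem c (hu.1 B), by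
    simp [← Finset.smul_sum, hu.2]⟩

/-- Tangency and harmonicity force the divergence to vanish. -/
theorem sum_pderiv_eq_zero_of_lap {u : Fin (n + 1) → Poly n} (hlap : ∀ B, lap n (u B) = 0)
    (hu : ∑ B, X B * u B = 0) : ∑ B, pderiv B (u B) = 0 := by
  have h := lap_sum_X_mul u
  rw [hu, map_zero] at h
  simpa [hlap] using h.symm

theorem isHomogeneous_sum_X_mul {k : ℕ} {u : Fin (n + 1) → Poly n}
    (hu : ∀ B, (u B).IsHomogeneous k) : (∑ B, X B * u B).IsHomogeneous (k + 1) :=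
  IsHomogeneous.sum _ _ _ fun B _ => by
    rw [add_comm k 1]; exact (isHomogeneous_X ℂ B).mul (hu B)

/-- A harmonic polynomial vector field differs from an element of `tangHarm` by fields whose
restriction to the unit sphere is a sum of gradients and of normal fields. -/
theorem exists_tangHarm_decomposition (hn : 2 ≤ n) {k : ℕ} {u : Fin (n + 1) → Poly n}
    (hu : ∀ B, u B ∈ harmPoly n (k + 1)) :
    ∃ w ∈ tangHarm n (k + 1), ∃ S h g : Poly n,
      ∀ B, u B = w B + (pderiv B S + X B * h + rsq n * pderiv B g) := by
  have hs := isHomogeneous_sum_X_mul fun B => (hu B).1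
  have hlap : lap n (lap n (∑ B, X B * u B)) = 0 := by
    rw [lap_sum_X_mul]
    have h0 : ∑ A, X A * lap n (u A) = 0 :=
      Finset.sum_eq_zero fun A _ => by rw [(mem_harmPoly.mp (hu A)).2, mul_zero]
    rw [h0, add_zero, two_mul, map_add, map_sum]
    have h1 : ∑ A, lap n (pderiv A (u A)) = 0 :=
      Finset.sum_eq_zero fun A _ => by rw [lap_pderiv, (mem_harmPoly.mp (hu A)).2, map_zero]
    rw [h1, add_zero]
  obtain ⟨S, h, g, h1, h2⟩ := exists_gradient_add_radial hn hs hlap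
  refine ⟨fun B => u B - (pderiv B S + X B * h + rsq n * pderiv B g),
    ⟨fun B => (harmPoly n (k + 1)).sub_mem (hu B) (h1 B), ?_⟩, S, h, g, fun B => by ring⟩
  simp only [mul_sub, Finset.sum_sub_distrib]
  rw [h2, sub_self]

/-! ### Dimensions -/

theorem finrank_homogeneousSubmodule (n k : ℕ) :
    Module.finrank ℂ (homogeneousSubmodule (Fin (n + 1)) ℂ k) = (n + k).choose k := by
  classical
  rw [homogeneousSubmodule_eq_finsupp_supported,
    (AddMonoidAlgebra.supportedEquivFinsupp {d : Fin (n + 1) →₀ ℕ | d.degree = k}).finrank_eq]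
  let e : Sym (Fin (n + 1)) k ≃ {d : Fin (n + 1) →₀ ℕ | d.degree = k} := Sym.equivNatSum _ k
  rw [(Finsupp.domLCongr (M := ℂ) (R := ℂ) e.symm).finrank_eq, Module.finrank_finsupp_self,
    Sym.card_sym_eq_multichoose, Nat.multichoose_eq, Fintype.card_fin,
    show n + 1 + k - 1 = n + k by omega]

theorem finrank_inf_ker_add_finrank_map {V W : Type*} [AddCommGroup V] [Module ℂ V]
    [AddCommGroup W] [Module ℂ W] (f : V →ₗ[ℂ] W) (S : Submodule ℂ V) [FiniteDimensional ℂ S] :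
    Module.finrank ℂ (S ⊓ LinearMap.ker f : Submodule ℂ V) + Module.finrank ℂ (S.map f) =
      Module.finrank ℂ S := by
  rw [← LinearMap.finrank_range_add_finrank_ker (f.domRestrict S), LinearMap.range_domRestrict,
    LinearMap.ker_domRestrict, add_comm]
  congr 1
  rw [← Submodule.map_comap_subtype S (LinearMap.ker f), Submodule.finrank_map_subtype_eq]

theorem harmPoly_eq_of_lt_two {k : ℕ} (hk : k < 2) :
    harmPoly n k = homogeneousSubmodule (Fin (n + 1)) ℂ k := by
  refine le_antisymm inf_le_left fun p hp => ⟨hp, ?_⟩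
  change lap n p = 0
  rw [lap_apply]
  refine Finset.sum_eq_zero fun A _ => ?_
  have h : (pderiv A p).IsHomogeneous 0 := by
    have := (show p.IsHomogeneous k from hp).pderiv (i := A)
    rwa [show k - 1 = 0 by omega] at this
  rw [← totalDegree_zero_iff_isHomogeneous, totalDegree_eq_zero_iff_eq_C] at h
  rw [h, pderiv_C]

theorem finrank_harmPoly_add_two (n k : ℕ) :
    Module.finrank ℂ (harmPoly n (k + 2)) + (n + k).choose k = (n + (k + 2)).choose (k + 2) := by
  rw [← finrank_homogeneousSubmodule, ← finrank_homogeneousSubmodule,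
    ← finrank_inf_ker_add_finrank_map (lap n) (homogeneousSubmodule (Fin (n + 1)) ℂ (k + 2))]
  have : (homogeneousSubmodule (Fin (n + 1)) ℂ (k + 2)).map (lap n) =
      homogeneousSubmodule (Fin (n + 1)) ℂ k := by
    apply le_antisymm
    · rintro _ ⟨p, hp, rfl⟩
      exact isHomogeneous_lap hp
    · intro f hf
      obtain ⟨p, hp, h⟩ := exists_lap_rsq_mul_eq hf
      refine ⟨rsq n * p, ?_, h⟩
      have := isHomogeneous_rsq.mul hp
      rwa [add_comm 2 k] at this
  rw [this, harmPoly]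

theorem finrank_harmPoly (hn : 2 ≤ n) (k : ℕ) :
    (Module.finrank ℂ (harmPoly n k) : ℚ) =
      ((n : ℚ) + 2 * k - 1) * ((n + k - 2).factorial : ℚ) /
        ((k.factorial : ℚ) * ((n - 1).factorial : ℚ)) := by
  obtain ⟨m, rfl⟩ := Nat.exists_eq_add_of_le' hn
  rw [show m + 2 + k - 2 = m + k by omega, show m + 2 - 1 = m + 1 by omega]
  have hm : (m.factorial : ℚ) ≠ 0 := by positivity
  match k with
  | 0 =>
    rw [harmPoly_eq_of_lt_two (by norm_num), finrank_homogeneousSubmodule]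
    simp only [Nat.factorial_succ, Nat.choose_zero_right, add_zero, Nat.factorial_zero]
    push_cast
    field_simp
    ring
  | 1 =>
    rw [harmPoly_eq_of_lt_two (by norm_num), finrank_homogeneousSubmodule, Nat.choose_one_right]
    simp only [Nat.factorial_succ, Nat.factorial_zero]
    push_cast
    field_simp
    ring
  | k + 2 =>
    have h := congrArg (Nat.cast (R := ℚ)) (finrank_harmPoly_add_two (m + 2) k)
    push_cast at h
    rw [eq_sub_of_add_eq h]
    rw [Nat.cast_choose ℚ (show k + 2 ≤ m + 2 + (k + 2) by omega),
      Nat.cast_choose ℚ (show k ≤ m + 2 + k by omega),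
      show m + 2 + (k + 2) - (k + 2) = m + 2 by omega, show m + 2 + k - k = m + 2 by omega,
      show m + 2 + (k + 2) = (m + k) + 4 by omega, show m + 2 + k = (m + k) + 2 by omega,
      show m + (k + 2) = (m + k) + 2 by omega]
    simp only [Nat.factorial_succ]
    have hk : (k.factorial : ℚ) ≠ 0 := by positivity
    push_cast
    field_simp
    ring

/-- The homogeneous biharmonic polynomials of degree `k`. -/
def biharmPoly (n k : ℕ) : Submodule ℂ (Poly n) :=
  homogeneousSubmodule (Fin (n + 1)) ℂ k ⊓ LinearMap.ker (lap n ∘ₗ lap n)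

theorem finrank_biharmPoly (k : ℕ) : Module.finrank ℂ (biharmPoly n (k + 2)) =
    Module.finrank ℂ (harmPoly n (k + 2)) + Module.finrank ℂ (harmPoly n k) := by
  have : FiniteDimensional ℂ (biharmPoly n (k + 2)) :=
    Submodule.finiteDimensional_of_le inf_le_left
  rw [← finrank_inf_ker_add_finrank_map (lap n)]
  have h1 : biharmPoly n (k + 2) ⊓ LinearMap.ker (lap n) = harmPoly n (k + 2) := by
    apply le_antisymm
    · exact fun p hp => ⟨hp.1.1, hp.2⟩
    · refine fun p hp => ⟨⟨hp.1, ?_⟩, hp.2⟩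
      change lap n (lap n p) = 0
      rw [(mem_harmPoly.mp hp).2, map_zero]
  have h2 : (biharmPoly n (k + 2)).map (lap n) = harmPoly n k := by
    apply le_antisymm
    · rintro _ ⟨p, hp, rfl⟩
      exact ⟨isHomogeneous_lap hp.1, hp.2⟩
    · intro f hf
      obtain ⟨p, hp, h⟩ := exists_lap_rsq_mul_eq hf.1
      refine ⟨rsq n * p, ⟨?_, ?_⟩, h⟩
      · have := isHomogeneous_rsq.mul hp
        rwa [add_comm 2 k] at this
      · change lap n (lap n _) = 0
        rw [h, (mem_harmPoly.mp hf).2]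
  rw [h1, h2]

/-- The exact sequence `0 → tangHarm → harmPoly^{n+1} → biharmPoly → 0`, whose second map takes
the radial component. -/
theorem finrank_tangHarm_add (hn : 2 ≤ n) (k : ℕ) :
    Module.finrank ℂ (tangHarm n (k + 1)) +
      (Module.finrank ℂ (harmPoly n (k + 2)) + Module.finrank ℂ (harmPoly n k)) =
        (n + 1) * Module.finrank ℂ (harmPoly n (k + 1)) := by
  let f : (Fin (n + 1) → harmPoly n (k + 1)) →ₗ[ℂ] Poly n :=
    ∑ B, LinearMap.mulLeft ℂ (X B) ∘ₗ (harmPoly n (k + 1)).subtype ∘ₗ LinearMap.proj B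
  have hf : ∀ u, f u = ∑ B, X B * (u B : Poly n) := fun u => by simp [f]
  have h1 : Module.finrank ℂ (LinearMap.ker f) = Module.finrank ℂ (tangHarm n (k + 1)) := by
    let e : LinearMap.ker f ≃ₗ[ℂ] tangHarm n (k + 1) :=
      { toFun := fun u => ⟨fun B => (u.1 B : Poly n), fun B => (u.1 B).2, by
          rw [← hf]; exact u.2⟩
        invFun := fun u => ⟨fun B => ⟨u.1 B, u.2.1 B⟩, by
          rw [LinearMap.mem_ker, hf]; exact u.2.2⟩
        map_add' := fun _ _ => rfl
        map_smul' := fun _ _ => rfl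
        left_inv := fun _ => rfl
        right_inv := fun _ => rfl }
    exact e.finrank_eq
  have h2 : LinearMap.range f = biharmPoly n (k + 2) := by
    apply le_antisymm
    · rintro _ ⟨u, rfl⟩
      rw [hf]
      refine ⟨isHomogeneous_sum_X_mul fun B => (u B).2.1, ?_⟩
      change lap n (lap n _) = 0
      rw [lap_sum_X_mul]
      have hu : ∀ B, lap n (u B : Poly n) = 0 := fun B => (u B).2.2
      simp [hu, two_mul, lap_pderiv]
    · intro s hs
      obtain ⟨S, h, g, h1, h2⟩ := exists_gradient_add_radial hn hs.1 hs.2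
      exact ⟨fun B => ⟨_, h1 B⟩, by rw [hf]; exact h2⟩
  rw [← finrank_biharmPoly, ← h1, ← h2, add_comm, LinearMap.finrank_range_add_finrank_ker,
    Module.finrank_pi_fintype]
  simp

theorem finrank_tangHarm (hn : 2 ≤ n) {l : ℕ} (hl : 1 ≤ l) :
    (Module.finrank ℂ (tangHarm n l) : ℚ) =
      (((n : ℚ) + 2 * l - 1) * ((n : ℚ) + l - 1) * ((n + l - 3).factorial : ℚ)) /
        (((l : ℚ) + 1) * ((l - 1).factorial : ℚ) * ((n - 2).factorial : ℚ)) := by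
  obtain ⟨k, rfl⟩ := Nat.exists_eq_add_of_le' hl
  have h := congrArg (Nat.cast (R := ℚ)) (finrank_tangHarm_add hn k)
  push_cast at h
  rw [eq_sub_of_add_eq h, finrank_harmPoly hn, finrank_harmPoly hn, finrank_harmPoly hn]
  obtain ⟨m, rfl⟩ := Nat.exists_eq_add_of_le' hn
  rw [show m + 2 + (k + 1) - 2 = (m + k) + 1 by omega, show m + 2 - 1 = m + 1 by omega,
    show m + 2 + (k + 2) - 2 = (m + k) + 2 by omega, show m + 2 + k - 2 = m + k by omega,
    show m + 2 + (k + 1) - 3 = m + k by omega, show k + 1 - 1 = k by omega,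
    show m + 2 - 2 = m by omega]
  simp only [Nat.factorial_succ]
  have hk : (k.factorial : ℚ) ≠ 0 := by positivity
  have hm : (m.factorial : ℚ) ≠ 0 := by positivity
  push_cast
  field_simp
  ring

/-! ### Polynomials as functions on the ambient space and on the sphere -/

/-- The value of a complex polynomial at a point of the (real) ambient space. -/
def evalAt (y : Ambient n) (p : Poly n) : ℂ := eval (fun i => ((y i : ℝ) : ℂ)) p

@[simp] theorem evalAt_add (y : Ambient n) (p q : Poly n) :
    evalAt y (p + q) = evalAt y p + evalAt y q := map_add _ _ _

@[simp] theorem evalAt_sub (y : Ambient n) (p q : Poly n) :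
    evalAt y (p - q) = evalAt y p - evalAt y q := map_sub _ _ _

@[simp] theorem evalAt_neg (y : Ambient n) (p : Poly n) : evalAt y (-p) = -evalAt y p :=
  map_neg _ _

@[simp] theorem evalAt_mul (y : Ambient n) (p q : Poly n) :
    evalAt y (p * q) = evalAt y p * evalAt y q := map_mul _ _ _

@[simp] theorem evalAt_zero (y : Ambient n) : evalAt y (0 : Poly n) = 0 := map_zero _

@[simp] theorem evalAt_one (y : Ambient n) : evalAt y (1 : Poly n) = 1 := map_one _

@[simp] theorem evalAt_smul (y : Ambient n) (c : ℂ) (p : Poly n) :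
    evalAt y (c • p) = c * evalAt y p := by simp [evalAt, smul_eval]

@[simp] theorem evalAt_sum {ι : Type*} (y : Ambient n) (s : Finset ι) (p : ι → Poly n) :
    evalAt y (∑ i ∈ s, p i) = ∑ i ∈ s, evalAt y (p i) := map_sum _ _ _

@[simp] theorem evalAt_X (y : Ambient n) (A : Fin (n + 1)) :
    evalAt y (X A) = ((y A : ℝ) : ℂ) := eval_X _

@[simp] theorem evalAt_C (y : Ambient n) (c : ℂ) : evalAt y (C c : Poly n) = c := eval_C _

theorem hasFDerivAt_evalAt (p : Poly n) (y : Ambient n) :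
    HasFDerivAt (fun z => evalAt z p)
      (∑ A, evalAt y (pderiv A p) •
        (Complex.ofRealCLM ∘L (EuclideanSpace.proj A : Ambient n →L[ℝ] ℝ))) y := by
  classical
  induction p using MvPolynomial.induction_on with
  | C a =>
    simp only [evalAt_C]
    refine (hasFDerivAt_const (𝕜 := ℝ) a y).congr_fderiv ?_
    ext v
    simp
  | add p q hp hq =>
    simp only [evalAt_add, map_add]
    refine (hp.fun_add hq).congr_fderiv ?_
    rw [← Finset.sum_add_distrib]
    exact Finset.sum_congr rfl fun A _ => (add_smul _ _ _).symm
  | mul_X p B hp =>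
    have hX : HasFDerivAt (fun z : Ambient n => ((z B : ℝ) : ℂ))
        (Complex.ofRealCLM ∘L (EuclideanSpace.proj B : Ambient n →L[ℝ] ℝ)) y :=
      (Complex.ofRealCLM ∘L (EuclideanSpace.proj B : Ambient n →L[ℝ] ℝ)).hasFDerivAt
    simp only [evalAt_mul, evalAt_X]
    refine (hp.mul hX).congr_fderiv ?_
    ext v
    simp [Derivation.leibniz, pderiv_X, Pi.single_apply, add_mul, Finset.sum_add_distrib,
      Finset.mul_sum, apply_ite (evalAt y), mul_assoc]

theorem contDiff_evalAt (p : Poly n) : ContDiff ℝ ∞ (fun y : Ambient n => evalAt y p) := by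
  induction p using MvPolynomial.induction_on with
  | C a => simpa using contDiff_const
  | add p q hp hq => simpa using hp.add hq
  | mul_X p B hp =>
    simp only [evalAt_mul, evalAt_X]
    exact hp.mul (Complex.ofRealCLM ∘L (EuclideanSpace.proj B : Ambient n →L[ℝ] ℝ)).contDiff

theorem evalAt_real_smul {k : ℕ} {p : Poly n} (hp : p.IsHomogeneous k) (r : ℝ) (y : Ambient n) :
    evalAt (r • y) p = (r : ℂ) ^ k * evalAt y p := by
  have h : (fun i => (((r • y) i : ℝ) : ℂ)) = fun i => (r : ℂ) * ((y i : ℝ) : ℂ) := by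
    funext i; simp
  rw [evalAt, h, evalAt, eval_eq, eval_eq, Finset.mul_sum]
  refine Finset.sum_congr rfl fun d hd => ?_
  have hk : d.degree = k := by
    rw [mem_support_iff] at hd
    have := hp hd
    rwa [Finsupp.degree_eq_weight_one]
  simp only [mul_pow, Finset.prod_mul_distrib]
  rw [Finset.prod_pow_eq_pow_sum, show ∑ i ∈ d.support, d i = k from hk]
  ring

/-- A homogeneous polynomial that vanishes on the unit sphere vanishes. -/
theorem eq_zero_of_evalAt_sphere {k : ℕ} {p : Poly n} (hp : p.IsHomogeneous k)
    (h : ∀ x : Sph n, evalAt (x : Ambient n) p = 0) : p = 0 := by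
  have h1 : ∀ y : Ambient n, y ≠ 0 → evalAt y p = 0 := by
    intro y hy
    have h2 : y = ‖y‖ • (toSph y hy : Ambient n) := by
      simp [toSph, smul_smul, mul_inv_cancel₀ (norm_ne_zero_iff.mpr hy)]
    rw [h2, evalAt_real_smul hp, h, mul_zero]
  -- All points of a box with positive real coordinates are nonzero.
  refine funext_set (fun _ => Complex.ofReal '' Set.Ioi 0)
    (fun _ => (Set.Ioi_infinite 0).image Complex.ofReal_injective.injOn) fun x hx => ?_
  choose y hy using fun i => hx i trivial
  have h3 := h1 (WithLp.toLp 2 y) (by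
    intro h0
    have := congrArg (fun z : Ambient n => z 0) h0
    simp only [PiLp.zero_apply] at this
    exact (ne_of_gt (hy 0).1) this)
  rw [map_zero]
  have h4 : x = fun i => ((y i : ℝ) : ℂ) := funext fun i => (hy i).2.symm
  rw [h4]
  exact h3

/-! ### Calculus on the sphere -/

theorem sum_coord_sq (x : Sph n) : ∑ A, coord A x * coord A x = 1 := by
  have h1 : ‖(x : Ambient n)‖ ^ 2 = 1 := by rw [norm_eq_of_mem_sphere x, one_pow]
  rw [EuclideanSpace.real_norm_sq_eq] at h1
  have := congrArg (Complex.ofReal) h1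
  simpa [coord, sq] using this

theorem hasFDerivAt_normalize (x : Sph n) :
    HasFDerivAt (fun z : Ambient n => ‖z‖⁻¹ • z)
      (ContinuousLinearMap.id ℝ (Ambient n) -
        (innerSL ℝ (x : Ambient n)).smulRight (x : Ambient n)) x := by
  have hx : ‖(x : Ambient n)‖ = 1 := norm_eq_of_mem_sphere x
  have h1 : HasFDerivAt (fun z : Ambient n => ‖z‖ ^ 2) ((2 : ℝ) • innerSL ℝ (x : Ambient n)) x := by
    refine (hasStrictFDerivAt_norm_sq (x : Ambient n)).hasFDerivAt.congr_fderiv ?_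
    ext v
    simp
  have h2 := (hasDerivAt_inv (x := √(‖(x : Ambient n)‖ ^ 2)) (by rw [hx]; norm_num)).comp_hasFDerivAt
    (x : Ambient n) (h1.sqrt (by rw [hx]; norm_num))
  have h3 := h2.smul (hasFDerivAt_id (x : Ambient n))
  refine (h3.congr_fderiv ?_).congr_of_eventuallyEq (Filter.Eventually.of_forall fun z => ?_)
  · ext v
    simp [hx]
    ring
  · simp [Real.sqrt_sq]

/-- The tangential derivative in terms of the derivative of an arbitrary ambient extension. -/
theorem tanD_of_hasFDerivAt {f : Sph n → ℂ} {g : Ambient n → ℂ} {g' : Ambient n →L[ℝ] ℂ}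
    {x : Sph n} (hfg : ∀ y : Sph n, f y = g y) (hg : HasFDerivAt g g' x) (A : Fin (n + 1)) :
    tanD A f x = g' (EuclideanSpace.single A 1) - coord A x * g' x := by
  have hx : ‖(x : Ambient n)‖ = 1 := norm_eq_of_mem_sphere x
  have h1 : HasFDerivAt g g' (‖(x : Ambient n)‖⁻¹ • (x : Ambient n)) := by
    simpa [hx] using hg
  have h2 := (h1.comp (f := fun z : Ambient n => ‖z‖⁻¹ • z) (x : Ambient n) (hasFDerivAt_normalize x)).congr_of_eventuallyEq
    (radialExt_eventuallyEq f g hfg x (coe_ne_zero x))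
  rw [tanD, h2.fderiv]
  simp [coord, EuclideanSpace.inner_single_right]

theorem sum_coord_mul_apply (x : Sph n) (L : Ambient n →L[ℝ] ℂ) :
    ∑ A, coord A x * L (EuclideanSpace.single A 1) = L x := by
  conv_rhs => rw [← (EuclideanSpace.basisFun (Fin (n + 1)) ℝ).sum_repr (x : Ambient n)]
  simp [map_sum, coord]

theorem sum_coord_mul_tanD {f : Sph n → ℂ} (hf : SmoothExt f) (x : Sph n) :
    ∑ A, coord A x * tanD A f x = 0 := by
  have h1 : HasFDerivAt (radialExt f) (fderiv ℝ (radialExt f) x) x :=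
    ((hf x (coe_ne_zero x)).differentiableAt (by simp)).hasFDerivAt
  have h2 : ∀ A, tanD A f x = _ := tanD_of_hasFDerivAt (fun y => (radialExt_coe f y).symm) h1
  simp only [h2, mul_sub, Finset.sum_sub_distrib, sum_coord_mul_apply]
  simp only [← mul_assoc, ← Finset.sum_mul, sum_coord_sq, one_mul, sub_self]

theorem tanD_mul {f g : Sph n → ℂ} (hf : SmoothExt f) (hg : SmoothExt g)
    (A : Fin (n + 1)) (x : Sph n) :
    tanD A (fun y => f y * g y) x = f x * tanD A g x + g x * tanD A f x := by
  have h : radialExt (fun y => f y * g y) = fun y => radialExt f y * radialExt g y := by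
    funext y
    by_cases hy : y ≠ 0 <;> simp [radialExt, hy]
  have h1 := (hf x (coe_ne_zero x)).differentiableAt (by simp)
  have h2 := (hg x (coe_ne_zero x)).differentiableAt (by simp)
  rw [tanD, h, fderiv_fun_mul h1 h2]
  simp [radialExt_coe, tanD]

theorem tanD_sum {ι : Type*} (s : Finset ι) {f : ι → Sph n → ℂ} (hf : ∀ i, SmoothExt (f i))
    (A : Fin (n + 1)) (x : Sph n) :
    tanD A (fun y => ∑ i ∈ s, f i y) x = ∑ i ∈ s, tanD A (f i) x := by
  have h : radialExt (fun y => ∑ i ∈ s, f i y) = fun y => ∑ i ∈ s, radialExt (f i) y := by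
    funext y
    by_cases hy : y ≠ 0 <;> simp [radialExt, hy]
  have h1 : ∀ i ∈ s, DifferentiableAt ℝ (radialExt (f i)) x :=
    fun i _ => (hf i x (coe_ne_zero x)).differentiableAt (by simp)
  rw [tanD, h, fderiv_fun_sum h1]
  simp [tanD]

theorem tanD_zero (A : Fin (n + 1)) (x : Sph n) : tanD A (fun _ => (0 : ℂ)) x = 0 := by
  have h := tanD_sum (n := n) (∅ : Finset Unit) (f := fun _ _ => 0) (fun _ => smoothExt_const 0) A x
  simpa using h

theorem tanD_evalAt (p : Poly n) (A : Fin (n + 1)) (x : Sph n) :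
    tanD A (fun y => evalAt (y : Ambient n) p) x =
      evalAt (x : Ambient n) (pderiv A p - X A * euler p) := by
  classical
  rw [tanD_of_hasFDerivAt (fun _ => rfl) (hasFDerivAt_evalAt p x)]
  simp only [sum_apply, evalAt_sub, evalAt_mul, euler, evalAt_sum, evalAt_X,
    smul_apply, ContinuousLinearMap.comp_apply, coord]
  congr 1
  · simp [apply_ite Complex.ofReal]
  · congr 1
    refine Finset.sum_congr rfl fun B _ => ?_
    simp [mul_comm]

theorem smoothExt_evalAt (p : Poly n) : SmoothExt (fun x : Sph n => evalAt (x : Ambient n) p) :=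
  smoothExt_of_ambient _ (fun y => evalAt y p) (fun _ => rfl) fun _ => (contDiff_evalAt p).contDiffAt

theorem tanD_coord (A B : Fin (n + 1)) (x : Sph n) : tanD A (coord B) x = tanProj x A B := by
  classical
  have h := tanD_evalAt (X B) A x
  simp only [evalAt_X] at h
  rw [show coord B = fun y : Sph n => (((y : Ambient n) B : ℝ) : ℂ) from rfl, h,
    euler_of_isHomogeneous (isHomogeneous_X ℂ B)]
  by_cases hAB : A = B
  · subst hAB
    simp [tanProj]
  · simp [tanProj, hAB, pderiv_X, Ne.symm hAB]

theorem tanProj_eq (x : Sph n) (A B : Fin (n + 1)) :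
    tanProj x A B = (if A = B then 1 else 0) - coord A x * coord B x := rfl

theorem sum_tanProj_mul (x : Sph n) (A : Fin (n + 1)) (v : Fin (n + 1) → ℂ) :
    ∑ B, tanProj x A B * v B = v A - coord A x * ∑ B, coord B x * v B := by
  simp [tanProj_eq, sub_mul, Finset.sum_sub_distrib, Finset.mul_sum, mul_assoc]

theorem tanProj_comm (x : Sph n) (A B : Fin (n + 1)) : tanProj x A B = tanProj x B A := by
  simp only [tanProj_eq, eq_comm (a := A), mul_comm (coord A x)]

theorem sum_tanProj_mul_tanD {f : Sph n → ℂ} (hf : SmoothExt f) (x : Sph n) (A : Fin (n + 1)) :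
    ∑ B, tanProj x A B * tanD B f x = tanD A f x := by
  rw [sum_tanProj_mul, sum_coord_mul_tanD hf, mul_zero, sub_zero]

theorem sum_tanD_coord (x : Sph n) : ∑ A, tanD A (coord A) x = n := by
  simp [tanD_coord, tanProj_eq, Finset.sum_sub_distrib, sum_coord_sq]

/-- The Laplace–Beltrami operator of the sphere on functions. -/
def sphLap (f : Sph n → ℂ) (x : Sph n) : ℂ := ∑ A, tanD A (tanD A f) x

theorem smoothExt_sphLap {f : Sph n → ℂ} (hf : SmoothExt f) : SmoothExt (sphLap f) :=
  smoothExt_sum _ (fun A x => tanD A (tanD A f) x) fun A => (hf.tanD A).tanD A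

theorem sphLap_mul {f g : Sph n → ℂ} (hf : SmoothExt f) (hg : SmoothExt g) (x : Sph n) :
    sphLap (fun y => f y * g y) x =
      f x * sphLap g x + 2 * ∑ A, tanD A f x * tanD A g x + g x * sphLap f x := by
  have h : ∀ A, tanD A (fun y => f y * g y) = fun y => f y * tanD A g y + g y * tanD A f y :=
    fun A => funext fun y => tanD_mul hf hg A y
  simp only [sphLap, h, Finset.mul_sum, ← Finset.sum_add_distrib]
  refine Finset.sum_congr rfl fun A _ => ?_
  rw [tanD_add (hf.mul (hg.tanD A)) (hg.mul (hf.tanD A)), tanD_mul hf (hg.tanD A),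
    tanD_mul hg (hf.tanD A)]
  ring

theorem sphLap_sum {ι : Type*} (s : Finset ι) {f : ι → Sph n → ℂ} (hf : ∀ i, SmoothExt (f i))
    (x : Sph n) : sphLap (fun y => ∑ i ∈ s, f i y) x = ∑ i ∈ s, sphLap (f i) x := by
  have h : ∀ A, tanD A (fun y => ∑ i ∈ s, f i y) = fun y => ∑ i ∈ s, tanD A (f i) y :=
    fun A => funext fun y => tanD_sum s hf A y
  simp only [sphLap, h]
  rw [Finset.sum_comm]
  exact Finset.sum_congr rfl fun A _ => tanD_sum s (fun i => (hf i).tanD A) A x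

/-- On the sphere, the Laplace–Beltrami operator and the ambient Laplacian of a homogeneous
polynomial differ by the eigenvalue of the spherical harmonics. -/
theorem sphLap_evalAt {k : ℕ} {p : Poly n} (hp : p.IsHomogeneous k) (x : Sph n) :
    sphLap (fun y => evalAt (y : Ambient n) p) x =
      evalAt (x : Ambient n) (lap n p) -
        (k : ℂ) * ((k : ℂ) + n - 1) * evalAt (x : Ambient n) p := by
  have h : ∀ A, tanD A (fun y : Sph n => evalAt (y : Ambient n) p) =
      fun y : Sph n => evalAt (y : Ambient n) (pderiv A p - (k : ℂ) • (X A * p)) := fun A => by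
    funext y
    rw [tanD_evalAt, euler_of_isHomogeneous hp, mul_smul_comm]
  have h2 : ∀ A, euler (pderiv A p - (k : ℂ) • (X A * p)) =
      ((k : ℂ) - 1) • pderiv A p - ((k : ℂ) * (k + 1)) • (X A * p) := fun A => by
    have h3 := euler_of_isHomogeneous ((isHomogeneous_X ℂ A).mul hp)
    have h4 := euler_pderiv hp A
    rw [euler] at h3 h4 ⊢
    simp only [map_sub, Derivation.map_smul, mul_sub, Finset.sum_sub_distrib, mul_smul_comm,
      ← Finset.smul_sum, h3, h4, smul_smul]
    push_cast
    rw [add_comm 1 (k : ℂ)]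
  have h5 := congrArg (evalAt (x : Ambient n)) (euler_of_isHomogeneous hp)
  simp only [euler, evalAt_sum, evalAt_mul, evalAt_X, evalAt_smul] at h5
  have h6 := sum_coord_sq x
  simp only [coord] at h6
  simp only [sphLap, h, tanD_evalAt, h2]
  simp only [map_sub, Derivation.map_smul, Derivation.leibniz, smul_eq_mul, pderiv_X_self, mul_one,
    evalAt_sub, evalAt_smul, evalAt_add, evalAt_mul, evalAt_X, lap_apply, evalAt_sum]
  have h7 : ∀ A, evalAt (x : Ambient n) (pderiv A (pderiv A p)) -
      (k : ℂ) * ((((x : Ambient n) A : ℝ) : ℂ) * evalAt (x : Ambient n) (pderiv A p) +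
        evalAt (x : Ambient n) p) -
      (((x : Ambient n) A : ℝ) : ℂ) * (((k : ℂ) - 1) * evalAt (x : Ambient n) (pderiv A p) -
        (k : ℂ) * (k + 1) * ((((x : Ambient n) A : ℝ) : ℂ) * evalAt (x : Ambient n) p)) =
      evalAt (x : Ambient n) (pderiv A (pderiv A p)) -
      (2 * k - 1) * ((((x : Ambient n) A : ℝ) : ℂ) * evalAt (x : Ambient n) (pderiv A p)) -
      k * evalAt (x : Ambient n) p + (k : ℂ) * (k + 1) * evalAt (x : Ambient n) p *
        ((((x : Ambient n) A : ℝ) : ℂ) * (((x : Ambient n) A : ℝ) : ℂ)) := fun A => by ring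
  simp only [h7, Finset.sum_add_distrib, Finset.sum_sub_distrib, ← Finset.mul_sum, h5, h6]
  simp
  ring

theorem sphLap_coord (B : Fin (n + 1)) (x : Sph n) : sphLap (coord B) x = -n * coord B x := by
  have h := sphLap_evalAt (isHomogeneous_X ℂ B) x
  simp only [evalAt_X] at h
  rw [show coord B = fun y : Sph n => (((y : Ambient n) B : ℝ) : ℂ) from rfl, h]
  simp [lap_apply, pderiv_X, Pi.single_apply, apply_ite]

/-! ### The rough Laplacian of tangent vector fields -/

section Tangent

variable {V : Sph n → Vec n}

theorem sum_coord_mul_tanD_tangent (hV : ∀ B, SmoothExt fun y => V y B) (hT : IsTangent V)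
    (A : Fin (n + 1)) (x : Sph n) : ∑ B, coord B x * tanD A (fun y => V y B) x = -V x A := by
  have h0 : (fun y => ∑ B, coord B y * V y B) = fun _ => 0 := funext hT
  have h := tanD_sum Finset.univ (fun B => (smoothExt_coord B).mul (hV B)) A x
  rw [h0, tanD_zero] at h
  simp only [tanD_mul (smoothExt_coord _) (hV _), Finset.sum_add_distrib, tanD_coord] at h
  have h2 := sum_tanProj_mul x A (fun B => V x B)
  rw [hT x, mul_zero, sub_zero] at h2
  simp only [mul_comm (V x _)] at h
  rw [h2] at h
  linear_combination -h

theorem covD_eq (hV : ∀ B, SmoothExt fun y => V y B) (hT : IsTangent V) (A B : Fin (n + 1)) :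
    covD V A B = fun x => tanD A (fun y => V y B) x + coord B x * V x A := by
  funext x
  rw [covD, sum_tanProj_mul, sum_coord_mul_tanD_tangent hV hT]
  ring

theorem divergence_eq (hV : ∀ B, SmoothExt fun y => V y B) (hT : IsTangent V) (x : Sph n) :
    divergence V x = ∑ A, tanD A (fun y => V y A) x := by
  simp only [divergence, covD_eq hV hT, Finset.sum_add_distrib]
  rw [hT x, add_zero]

theorem sum_coord_mul_sphLap (hV : ∀ B, SmoothExt fun y => V y B) (hT : IsTangent V) (x : Sph n) :
    ∑ B, coord B x * sphLap (fun y => V y B) x = -2 * divergence V x := by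
  have h0 : (fun y => ∑ B, coord B y * V y B) = fun _ => 0 := funext hT
  have h := sphLap_sum Finset.univ (fun B => (smoothExt_coord B).mul (hV B)) x
  have h1 : sphLap (fun y : Sph n => (0 : ℂ)) x = 0 := by
    have : ∀ A, tanD A (fun y : Sph n => (0 : ℂ)) = fun _ => 0 := fun A => funext (tanD_zero A)
    simp [sphLap, this, tanD_zero]
  rw [h0, h1] at h
  have h2 : ∀ B, sphLap (fun y => coord B y * V y B) x =
      coord B x * sphLap (fun y => V y B) x + 2 * tanD B (fun y => V y B) x -
        n * (coord B x * V x B) := fun B => by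
    rw [sphLap_mul (smoothExt_coord B) (hV B), sphLap_coord]
    simp only [tanD_coord, tanProj_comm x _ B, sum_tanProj_mul_tanD (hV B)]
    ring
  simp only [h2, Finset.sum_sub_distrib, Finset.sum_add_distrib, ← Finset.mul_sum, hT x] at h
  rw [divergence_eq hV hT]
  linear_combination -h

theorem laplacian_eq (hV : ∀ B, SmoothExt fun y => V y B) (hT : IsTangent V) (C : Fin (n + 1))
    (x : Sph n) :
    laplacian V C x =
      sphLap (fun y => V y C) x + V x C + 2 * coord C x * divergence V x := by
  have hW : ∀ B C, SmoothExt (covD V B C) := fun B C => by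
    rw [covD_eq hV hT]
    exact ((hV C).tanD B).add ((smoothExt_coord C).mul (hV B))
  have h1 : ∀ C', ∑ B, tanD B (covD V B C') x =
      sphLap (fun y => V y C') x + V x C' + coord C' x * divergence V x := fun C' => by
    simp only [covD_eq hV hT]
    have h2 : ∀ B, tanD B (fun y => tanD B (fun z => V z C') y + coord C' y * V y B) x =
        tanD B (tanD B (fun z => V z C')) x + (coord C' x * tanD B (fun y => V y B) x +
          tanProj x C' B * V x B) := fun B => by
      rw [tanD_add ((hV C').tanD B) ((smoothExt_coord C').mul (hV B)),
        tanD_mul (smoothExt_coord C') (hV B), tanD_coord, tanProj_comm]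
      ring
    simp only [h2, Finset.sum_add_distrib, ← Finset.mul_sum]
    rw [sum_tanProj_mul, hT x, ← divergence_eq hV hT, sphLap]
    ring
  have h3 : laplacian V C x = ∑ C', tanProj x C C' * ∑ B, tanD B (covD V B C') x := by
    simp only [laplacian, covD2]
    calc _ = ∑ A, ∑ C', ∑ B', tanProj x A B' * tanProj x C C' * tanD A (covD V B' C') x :=
          Finset.sum_congr rfl fun A _ => Finset.sum_comm
      _ = ∑ C', ∑ A, ∑ B', tanProj x A B' * tanProj x C C' * tanD A (covD V B' C') x :=
          Finset.sum_comm
      _ = ∑ C', ∑ B', ∑ A, tanProj x A B' * tanProj x C C' * tanD A (covD V B' C') x :=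
          Finset.sum_congr rfl fun C' _ => Finset.sum_comm
      _ = _ := by
          refine Finset.sum_congr rfl fun C' _ => ?_
          rw [Finset.mul_sum]
          refine Finset.sum_congr rfl fun B' _ => ?_
          rw [← sum_tanProj_mul_tanD (hW B' C') x B', Finset.mul_sum]
          refine Finset.sum_congr rfl fun A _ => ?_
          rw [tanProj_comm x A B']
          ring
  rw [h3, sum_tanProj_mul]
  simp only [h1, mul_add, Finset.sum_add_distrib]
  rw [sum_coord_mul_sphLap hV hT, hT x]
  simp only [← mul_assoc, ← Finset.sum_mul, sum_coord_sq]
  ring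

end Tangent

/-! ### Integration by parts on the sphere -/

instance : IsFiniteMeasure (surfaceMeasure n) := by unfold surfaceMeasure; infer_instance

instance : (surfaceMeasure n).IsOpenPosMeasure := by unfold surfaceMeasure; infer_instance

theorem SmoothExt.continuous {f : Sph n → ℂ} (hf : SmoothExt f) : Continuous f := by
  rw [continuous_iff_continuousAt]
  intro x
  have h := (hf x (coe_ne_zero x)).continuousAt.comp (continuous_subtype_val.continuousAt (x := x))
  refine h.congr (Filter.Eventually.of_forall fun y => radialExt_coe f y)

theorem integrable_of_continuous {E : Type*} [NormedAddCommGroup E] {f : Sph n → E}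
    (hf : Continuous f) : Integrable f (surfaceMeasure n) :=
  hf.integrable_of_hasCompactSupport (HasCompactSupport.of_compactSpace f)

theorem SmoothExt.integrable {f : Sph n → ℂ} (hf : SmoothExt f) :
    Integrable f (surfaceMeasure n) := integrable_of_continuous hf.continuous

theorem surfaceMeasure_real_univ_pos (n : ℕ) : 0 < (surfaceMeasure n).real Set.univ := by
  refine ENNReal.toReal_pos ?_ (measure_ne_top _ _)
  exact Measure.measure_univ_ne_zero.mpr (Measure.toSphere_ne_zero _)

/-- The radial measure `r^n dr` of polar coordinates. -/
abbrev radialMeasure (n : ℕ) : Measure (Set.Ioi (0 : ℝ)) :=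
  Measure.volumeIoiPow (Module.finrank ℝ (Ambient n) - 1)

theorem integral_polar {E : Type*} [NormedAddCommGroup E] [NormedSpace ℝ E]
    (G : Ambient n → E) :
    ∫ y, G y = ∫ p : Sph n × Set.Ioi (0 : ℝ), G ((p.2 : ℝ) • (p.1 : Ambient n))
      ∂((surfaceMeasure n).prod (radialMeasure n)) := by
  rw [← restrict_compl_singleton (μ := (volume : Measure (Ambient n))) 0,
    ← integral_subtype_comap (measurableSet_singleton _).compl]
  rw [surfaceMeasure, ← ((volume : Measure (Ambient n)).measurePreserving_homeomorphUnitSphereProd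
    ).integral_comp (Homeomorph.measurableEmbedding _)]
  refine integral_congr_ae (Filter.Eventually.of_forall fun y => ?_)
  have hy : ‖(y : Ambient n)‖ ≠ 0 := norm_ne_zero_iff.mpr y.2
  simp [smul_smul, mul_inv_cancel₀ hy]

/-- A radial cut-off removes a singularity at the origin. -/
theorem continuous_cutoff_mul {H : ℝ → ℝ} (hH : Continuous H)
    (h0 : ∀ r, r ∉ Set.Icc (1 : ℝ) 3 → H r = 0) {g : Ambient n → ℂ}
    (hg : ∀ y, y ≠ 0 → ContinuousAt g y) : Continuous fun y => (H ‖y‖ : ℂ) * g y := by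
  rw [continuous_iff_continuousAt]
  intro y
  by_cases hy : y = 0
  · have : (fun y : Ambient n => (H ‖y‖ : ℂ) * g y) =ᶠ[nhds y] fun _ => 0 := by
      subst hy
      filter_upwards [ball_mem_nhds (0 : Ambient n) one_pos] with z hz
      rw [mem_ball_zero_iff] at hz
      rw [h0 _ fun h => absurd h.1 (not_le.mpr hz)]
      simp
    exact continuousAt_const.congr this.symm
  · exact ((Complex.continuous_ofReal.comp (hH.comp continuous_norm)).continuousAt).mul (hg y hy)

theorem hasCompactSupport_cutoff_mul {H : ℝ → ℝ}
    (h0 : ∀ r, r ∉ Set.Icc (1 : ℝ) 3 → H r = 0) (g : Ambient n → ℂ) :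
    HasCompactSupport fun y => (H ‖y‖ : ℂ) * g y := by
  refine HasCompactSupport.intro (isCompact_closedBall (0 : Ambient n) 3) fun y hy => ?_
  rw [mem_closedBall_zero_iff] at hy
  rw [h0 _ fun h => hy h.2]
  simp

theorem integrable_cutoff_mul {H : ℝ → ℝ} (hH : Continuous H)
    (h0 : ∀ r, r ∉ Set.Icc (1 : ℝ) 3 → H r = 0) {g : Ambient n → ℂ}
    (hg : ∀ y, y ≠ 0 → ContinuousAt g y) : Integrable fun y => (H ‖y‖ : ℂ) * g y :=
  (continuous_cutoff_mul hH h0 hg).integrable_of_hasCompactSupport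
    (hasCompactSupport_cutoff_mul h0 g)

theorem radialExt_smul (f : Sph n → ℂ) (r : Set.Ioi (0 : ℝ)) (x : Sph n) :
    radialExt f ((r : ℝ) • (x : Ambient n)) = f x := by
  have hr : (0 : ℝ) < r := r.2
  have hx : ‖(x : Ambient n)‖ = 1 := norm_eq_of_mem_sphere x
  have h0 : (r : ℝ) • (x : Ambient n) ≠ 0 := smul_ne_zero hr.ne' (coe_ne_zero x)
  have h1 : toSph ((r : ℝ) • (x : Ambient n)) h0 = x := by
    apply Subtype.ext
    simp [toSph, norm_smul, hx, abs_of_pos hr, smul_smul, inv_mul_cancel₀ hr.ne']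
  rw [radialExt, dif_pos h0, h1]

/-- The derivative of the radial extension is homogeneous of degree `-1`. -/
theorem fderiv_radialExt_smul {f : Sph n → ℂ} (hf : SmoothExt f) (r : Set.Ioi (0 : ℝ)) (x : Sph n)
    (A : Fin (n + 1)) :
    fderiv ℝ (radialExt f) ((r : ℝ) • (x : Ambient n)) (EuclideanSpace.single A 1) =
      ((r : ℝ) : ℂ)⁻¹ * tanD A f x := by
  have hr : (0 : ℝ) < r := r.2
  have h0 : (r : ℝ) • (x : Ambient n) ≠ 0 := smul_ne_zero hr.ne' (coe_ne_zero x)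
  have h1 : (fun y : Ambient n => radialExt f ((r : ℝ) • y)) =ᶠ[nhds (x : Ambient n)]
      radialExt f := by
    filter_upwards [isOpen_ne.mem_nhds (coe_ne_zero x)] with y hy
    have h2 : y = ‖y‖ • (toSph y hy : Ambient n) := by
      simp [toSph, smul_smul, mul_inv_cancel₀ (norm_ne_zero_iff.mpr hy)]
    have hy' := norm_pos_iff.mpr hy
    rw [h2, smul_smul]
    rw [radialExt_smul f ⟨(r : ℝ) * ‖y‖, mul_pos hr hy'⟩, radialExt_smul f ⟨‖y‖, hy'⟩]
  have h3 : HasFDerivAt (radialExt f) _ ((r : ℝ) • (x : Ambient n)) :=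
    ((hf _ h0).differentiableAt (by simp)).hasFDerivAt
  have h4 := h3.comp (x : Ambient n) ((hasFDerivAt_id (x : Ambient n)).const_smul (r : ℝ))
  have h5 := (h4.congr_of_eventuallyEq (f₁ := radialExt f) h1.symm).fderiv
  rw [tanD, h5]
  have : ((r : ℝ) : ℂ) ≠ 0 := by exact_mod_cast hr.ne'
  simp [this]

theorem integral_fderiv_eq_zero {F : Ambient n → ℂ} (hF : ContDiff ℝ 1 F)
    (hc : HasCompactSupport F) (v : Ambient n) : ∫ y, fderiv ℝ F y v = 0 := by
  have hd : Continuous fun y => fderiv ℝ F y v :=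
    (hF.continuous_fderiv (by simp)).clm_apply continuous_const
  have h := integral_mul_fderiv_eq_neg_fderiv_mul_of_integrable (𝕜 := ℂ)
    (μ := (volume : Measure (Ambient n))) (f := fun _ => (1 : ℂ)) (g := F) (v := v)
    (by simp) (by
      simpa using hd.integrable_of_hasCompactSupport (hc.fderiv_apply ℝ v))
    (by simpa using hF.continuous.integrable_of_hasCompactSupport hc)
    (fun _ _ => differentiableAt_const _) (fun _ _ => hF.differentiable (by simp) _)
  simpa using h

/-- Integrating the derivative of `φ(‖y‖) f(y/‖y‖)` in polar coordinates relates the sphere integrals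
of `tanD A f` and of `coord A * f`. The constants `a` and `c` do not depend on `f`. -/
theorem exists_integral_tanD (n : ℕ) : ∃ a c : ℂ, c ≠ 0 ∧
    ∀ f : Sph n → ℂ, SmoothExt f → ∀ A,
      a * ∫ x, coord A x * f x ∂(surfaceMeasure n) + c * ∫ x, tanD A f x ∂(surfaceMeasure n) = 0 := by
  let φ : ContDiffBump (2 : ℝ) := ⟨1 / 2, 1, by norm_num, by norm_num⟩
  have hφ0 : ∀ r, r ∉ Set.Icc (1 : ℝ) 3 → φ r = 0 := by
    intro r hr
    by_contra h
    have : r ∈ Function.support φ := h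
    rw [φ.support_eq, Real.ball_eq_Ioo] at this
    exact hr ⟨by have := this.1; norm_num [φ] at this; linarith,
      by have := this.2; norm_num [φ] at this; linarith⟩
  have hφ' : ∀ r, r ∉ Set.Icc (1 : ℝ) 3 → deriv φ r = 0 := by
    intro r hr
    by_contra h
    have : r ∈ tsupport φ := support_deriv_subset h
    rw [φ.tsupport_eq, Real.closedBall_eq_Icc] at this
    exact hr ⟨by have := this.1; norm_num [φ] at this; linarith,
      by have := this.2; norm_num [φ] at this; linarith⟩
  have hφc : ContDiff ℝ ∞ φ := φ.contDiff
  have hdc : Continuous (deriv φ) := hφc.continuous_deriv (by simp)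
  refine ⟨((∫ r, deriv φ (r : ℝ) ∂(radialMeasure n) : ℝ) : ℂ),
    ((∫ r, φ (r : ℝ) * (r : ℝ)⁻¹ ∂(radialMeasure n) : ℝ) : ℂ), ?_, ?_⟩
  · -- The constant times the area is the ambient integral of a nonnegative nonzero function.
    intro h0
    have h1 := integral_polar (n := n) (fun y => φ ‖y‖ * ‖y‖⁻¹)
    have h2 : ∀ p : Sph n × Set.Ioi (0 : ℝ), ‖(p.2 : ℝ) • (p.1 : Ambient n)‖ = p.2 := fun p => by
      have hr : (0 : ℝ) < p.2 := p.2.2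
      rw [norm_smul, norm_eq_of_mem_sphere p.1, mul_one, Real.norm_of_nonneg hr.le]
    simp only [h2] at h1
    rw [integral_fun_snd (fun r : Set.Ioi (0 : ℝ) => φ (r : ℝ) * (r : ℝ)⁻¹),
      Complex.ofReal_eq_zero.mp h0, smul_zero] at h1
    have hcont : Continuous fun y : Ambient n => φ ‖y‖ * ‖y‖⁻¹ := by
      have h3 := continuous_cutoff_mul (n := n) φ.continuous hφ0
        (g := fun y => ((‖y‖⁻¹ : ℝ) : ℂ)) (fun y hy =>
          Complex.continuous_ofReal.continuousAt.comp
            (continuous_norm.continuousAt.inv₀ (norm_ne_zero_iff.mpr hy)))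
      have h4 := Complex.continuous_re.comp h3
      refine h4.congr fun y => ?_
      simp
    have hcs : HasCompactSupport fun y : Ambient n => φ ‖y‖ * ‖y‖⁻¹ := by
      refine HasCompactSupport.intro (isCompact_closedBall (0 : Ambient n) 3) fun y hy => ?_
      rw [mem_closedBall_zero_iff] at hy
      rw [hφ0 _ fun h => hy h.2, zero_mul]
    have h5 := hcont.integral_pos_of_hasCompactSupport_nonneg_nonzero (μ := volume) hcs
      (fun y => mul_nonneg φ.nonneg (inv_nonneg.mpr (norm_nonneg y)))
      (x := EuclideanSpace.single 0 2) (by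
        have : φ 2 = 1 := φ.one_of_mem_closedBall (by simp [φ])
        simp [this])
    linarith
  · intro f hf A
    have hcf := (smoothExt_coord A).mul hf
    have hgc : ∀ y : Ambient n, y ≠ 0 → ContinuousAt
        (fun y => fderiv ℝ (radialExt f) y (EuclideanSpace.single A (1 : ℝ))) y := fun y hy =>
      (((hf y hy).fderiv_right (m := ∞) le_rfl).clm_apply contDiffAt_const).continuousAt
    let F : Ambient n → ℂ := fun y => (φ ‖y‖ : ℂ) * radialExt f y
    have hF : ContDiff ℝ 1 F := by
      rw [contDiff_iff_contDiffAt]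
      intro y
      by_cases hy : y = 0
      · have : F =ᶠ[nhds y] fun _ => 0 := by
          subst hy
          filter_upwards [ball_mem_nhds (0 : Ambient n) one_pos] with z hz
          rw [mem_ball_zero_iff] at hz
          simp only [F]
          rw [hφ0 _ fun h => absurd h.1 (not_le.mpr hz)]
          simp
        exact contDiffAt_const.congr_of_eventuallyEq this
      · refine ContDiffAt.mul ?_ ((hf y hy).of_le (by simp))
        exact Complex.ofRealCLM.contDiff.contDiffAt.comp y
          ((hφc.of_le (by simp)).contDiffAt.comp y (contDiffAt_norm ℝ hy))
    have h1 := integral_fderiv_eq_zero hF (hasCompactSupport_cutoff_mul hφ0 _)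
      (EuclideanSpace.single A (1 : ℝ))
    have h2 : (fun y => fderiv ℝ F y (EuclideanSpace.single A (1 : ℝ))) =ᵐ[volume] fun y =>
        ((deriv φ ‖y‖ : ℝ) : ℂ) * radialExt (fun x => coord A x * f x) y +
        (φ ‖y‖ : ℂ) * fderiv ℝ (radialExt f) y (EuclideanSpace.single A (1 : ℝ)) := by
      have : ∀ᵐ y : Ambient n, y ≠ 0 := by
        simp [ae_iff]
      filter_upwards [this] with y hy
      have hnorm : HasFDerivAt (fun z : Ambient n => ‖z‖) (fderiv ℝ (fun z : Ambient n => ‖z‖) y) y :=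
        ((contDiffAt_norm ℝ hy).differentiableAt (n := 1) (by simp)).hasFDerivAt
      have hsq : HasFDerivAt (fun z : Ambient n => ‖z‖ ^ 2) _ y :=
        (hasStrictFDerivAt_norm_sq y).hasFDerivAt
      have hnd : fderiv ℝ (fun z : Ambient n => ‖z‖) y (EuclideanSpace.single A (1 : ℝ)) =
          ‖y‖⁻¹ * y A := by
        have h3 := congrArg (fun L : Ambient n →L[ℝ] ℝ => L (EuclideanSpace.single A (1 : ℝ)))
          ((hnorm.pow 2).unique hsq)
        simp [EuclideanSpace.inner_single_right] at h3
        have := norm_ne_zero_iff.mpr hy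
        field_simp
        linarith
      have hφd : HasFDerivAt (fun z : Ambient n => (φ ‖z‖ : ℂ)) _ y :=
        Complex.ofRealCLM.hasFDerivAt.comp y
          (((hφc.differentiable (by simp)) ‖y‖).hasDerivAt.comp_hasFDerivAt y hnorm)
      have hfd : HasFDerivAt (radialExt f) _ y := ((hf y hy).differentiableAt (by simp)).hasFDerivAt
      have hFd : HasFDerivAt F _ y := hφd.mul hfd
      rw [hFd.fderiv]
      have h4 : radialExt (fun x => coord A x * f x) y =
          ((‖y‖⁻¹ * y A : ℝ) : ℂ) * radialExt f y := by
        simp [radialExt, hy, coord, toSph]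
      rw [h4]
      simp [hnd]
      ring
    rw [integral_congr_ae h2, integral_add
      (integrable_cutoff_mul hdc hφ' fun y hy => (hcf y hy).continuousAt)
      (integrable_cutoff_mul φ.continuous hφ0 hgc), integral_polar, integral_polar] at h1
    have h2 : ∀ p : Sph n × Set.Ioi (0 : ℝ), ‖(p.2 : ℝ) • (p.1 : Ambient n)‖ = p.2 := fun p => by
      have hr : (0 : ℝ) < p.2 := p.2.2
      rw [norm_smul, norm_eq_of_mem_sphere p.1, mul_one, Real.norm_of_nonneg hr.le]
    simp only [h2, radialExt_smul, fderiv_radialExt_smul hf] at h1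
    rw [← h1, ← integral_complex_ofReal, ← integral_complex_ofReal]
    congr 1
    · rw [mul_comm, ← integral_prod_mul]
      refine integral_congr_ae (Filter.Eventually.of_forall fun p => ?_)
      simp [mul_comm]
    · rw [mul_comm, ← integral_prod_mul]
      refine integral_congr_ae (Filter.Eventually.of_forall fun p => ?_)
      simp
      ring

/-- The divergence theorem on the sphere. -/
theorem integral_tanD {f : Sph n → ℂ} (hf : SmoothExt f) (A : Fin (n + 1)) :
    ∫ x, tanD A f x ∂(surfaceMeasure n) = n * ∫ x, coord A x * f x ∂(surfaceMeasure n) := by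
  obtain ⟨a, c, hc, h⟩ := exists_integral_tanD n
  -- The ratio of the constants is found by testing with the coordinate functions.
  have h1 : ∑ B, (a * ∫ x, coord B x * coord B x ∂(surfaceMeasure n) +
      c * ∫ x, tanD B (coord B) x ∂(surfaceMeasure n)) = 0 :=
    Finset.sum_eq_zero fun B _ => h _ (smoothExt_coord B) B
  rw [Finset.sum_add_distrib, ← Finset.mul_sum, ← Finset.mul_sum,
    ← integral_finsetSum _ (fun B _ => ((smoothExt_coord B).mul (smoothExt_coord B)).integrable),
    ← integral_finsetSum _ (fun B _ => ((smoothExt_coord B).tanD B).integrable)] at h1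
  simp only [sum_coord_sq, sum_tanD_coord, integral_const, Complex.real_smul] at h1
  have h2 : (((surfaceMeasure n).real Set.univ : ℝ) : ℂ) ≠ 0 := by
    exact_mod_cast (surfaceMeasure_real_univ_pos n).ne'
  have h3 : a = -(n * c) := by
    apply mul_right_cancel₀ h2
    linear_combination h1
  apply mul_left_cancel₀ hc
  have h4 := h f hf A
  rw [h3] at h4
  linear_combination h4

/-! ### Sphere integrals of polynomials -/

theorem integrable_evalAt (p : Poly n) :
    Integrable (fun x : Sph n => evalAt (x : Ambient n) p) (surfaceMeasure n) :=
  (smoothExt_evalAt p).integrable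

theorem euler_mul (p q : Poly n) : euler (p * q) = euler p * q + p * euler q := by
  simp only [euler, Derivation.leibniz, smul_eq_mul, Finset.sum_mul, Finset.mul_sum,
    ← Finset.sum_add_distrib]
  exact Finset.sum_congr rfl fun A _ => by ring

theorem integral_pderiv (p : Poly n) (A : Fin (n + 1)) :
    ∫ x : Sph n, evalAt (x : Ambient n) (pderiv A p) ∂(surfaceMeasure n) =
      ∫ x : Sph n, evalAt (x : Ambient n) (X A * ((n : ℂ) • p + euler p)) ∂(surfaceMeasure n) := by
  have h := integral_tanD (smoothExt_evalAt p) A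
  simp only [tanD_evalAt] at h
  simp only [evalAt_sub] at h
  rw [integral_sub (integrable_evalAt _) (integrable_evalAt _)] at h
  rw [eq_add_of_sub_eq h, ← integral_const_mul, ← integral_add]
  · refine integral_congr_ae (Filter.Eventually.of_forall fun x => ?_)
    simp [coord]
    ring
  · exact (((smoothExt_coord A).mul (smoothExt_evalAt p)).integrable).const_mul _
  · exact integrable_evalAt _

/-- Integration by parts: for harmonic `p` the gradient pairing is a multiple of the `L²` pairing. -/
theorem sum_integral_pderiv_mul_pderiv {k l : ℕ} {p q : Poly n} (hp : p ∈ harmPoly n k)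
    (hq : q.IsHomogeneous l) :
    ∑ A, ∫ x : Sph n, evalAt (x : Ambient n) (pderiv A p * pderiv A q) ∂(surfaceMeasure n) =
      (k : ℂ) * ((n : ℂ) + k + l - 1) *
        ∫ x : Sph n, evalAt (x : Ambient n) (p * q) ∂(surfaceMeasure n) := by
  have h1 : ∀ A, ∫ x : Sph n, evalAt (x : Ambient n) (pderiv A p * pderiv A q) ∂(surfaceMeasure n) =
      ∫ x : Sph n, evalAt (x : Ambient n)
        (((n : ℂ) + k + l - 1) • (X A * pderiv A p * q) - pderiv A (pderiv A p) * q)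
        ∂(surfaceMeasure n) := by
    intro A
    have h := integral_pderiv (pderiv A p * q) A
    have e1 : pderiv A (pderiv A p * q) = pderiv A p * pderiv A q + pderiv A (pderiv A p) * q := by
      simp only [Derivation.leibniz, smul_eq_mul]
      ring
    have e2 : X A * ((n : ℂ) • (pderiv A p * q) + euler (pderiv A p * q)) =
        ((n : ℂ) + k + l - 1) • (X A * pderiv A p * q) := by
      rw [euler_mul, euler_pderiv hp.1, euler_of_isHomogeneous hq]
      simp only [smul_eq_C_mul, map_sub, map_add, map_one]
      ring
    rw [e1, e2] at h
    simp only [evalAt_add] at h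
    rw [integral_add (integrable_evalAt _) (integrable_evalAt _)] at h
    simp only [evalAt_sub]
    rw [integral_sub (integrable_evalAt _) (integrable_evalAt _), ← h]
    ring
  simp only [h1]
  rw [← integral_finsetSum _ (fun A _ => integrable_evalAt _), ← integral_const_mul]
  refine integral_congr_ae (Filter.Eventually.of_forall fun x => ?_)
  simp only
  rw [← evalAt_sum, ← evalAt_smul, Finset.sum_sub_distrib, ← Finset.sum_mul, ← lap_apply,
    (mem_harmPoly.mp hp).2, zero_mul, sub_zero, ← Finset.smul_sum, ← Finset.sum_mul, ← euler,
    euler_of_isHomogeneous hp.1, smul_mul_assoc, smul_smul, mul_comm (k : ℂ)]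

theorem natCast_add_add_sub_one_ne_zero (hn : 2 ≤ n) (k l : ℕ) : (n : ℂ) + k + l - 1 ≠ 0 := by
  have h : (n : ℝ) + k + l - 1 ≠ 0 := by
    have h1 : (2 : ℝ) ≤ n := by exact_mod_cast hn
    have h2 : (0 : ℝ) ≤ k := by positivity
    have h3 : (0 : ℝ) ≤ l := by positivity
    linarith
  exact_mod_cast h

/-- Both degrees can play the role of `k` in `sum_integral_pderiv_mul_pderiv`, and the resulting
factors differ. -/
theorem integral_mul_eq_zero_of_ne (hn : 2 ≤ n) {k l : ℕ} (hkl : k ≠ l) {p q : Poly n}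
    (hp : p ∈ harmPoly n k) (hq : q ∈ harmPoly n l) :
    ∫ x : Sph n, evalAt (x : Ambient n) (p * q) ∂(surfaceMeasure n) = 0 := by
  have h1 := sum_integral_pderiv_mul_pderiv hp hq.1
  have h2 := sum_integral_pderiv_mul_pderiv hq hp.1
  simp only [mul_comm q p, mul_comm (pderiv _ q)] at h2
  have h3 : ((k : ℂ) - l) * ((n : ℂ) + k + l - 1) *
      ∫ x : Sph n, evalAt (x : Ambient n) (p * q) ∂(surfaceMeasure n) = 0 := by
    linear_combination h2 - h1
  have e1 : (k : ℂ) - l ≠ 0 := sub_ne_zero.mpr (by exact_mod_cast hkl)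
  simpa [e1, natCast_add_add_sub_one_ne_zero hn k l] using h3

/-! ### Complex conjugation of polynomials -/

/-- The polynomial with conjugated coefficients. -/
def conjPoly (p : Poly n) : Poly n := map (starRingEnd ℂ) p

theorem evalAt_conjPoly (y : Ambient n) (p : Poly n) : evalAt y (conjPoly p) = conj (evalAt y p) := by
  induction p using MvPolynomial.induction_on with
  | C a => simp [conjPoly]
  | add p q hp hq =>
    rw [conjPoly, map_add, evalAt_add, evalAt_add, map_add]
    exact congrArg₂ (· + ·) hp hq
  | mul_X p A hp =>
    rw [conjPoly, map_mul, evalAt_mul, evalAt_mul, map_mul, map_X, evalAt_X, Complex.conj_ofReal]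
    exact congrArg (· * _) hp

theorem conjPoly_mem_harmPoly {k : ℕ} {p : Poly n} (hp : p ∈ harmPoly n k) :
    conjPoly p ∈ harmPoly n k := by
  refine ⟨IsHomogeneous.map hp.1 _, ?_⟩
  change lap n _ = 0
  have h : lap n (conjPoly p) = conjPoly (lap n p) := by
    simp only [lap_apply, conjPoly, pderiv_map, map_sum]
  rw [h, (mem_harmPoly.mp hp).2, conjPoly, map_zero]

theorem eq_zero_of_integral_conjPoly_mul {k : ℕ} {p : Poly n} (hp : p.IsHomogeneous k)
    (h : ∫ x : Sph n, evalAt (x : Ambient n) (conjPoly p * p) ∂(surfaceMeasure n) = 0) : p = 0 := by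
  refine eq_zero_of_evalAt_sphere hp fun x => ?_
  have hc : Continuous fun x : Sph n => evalAt (x : Ambient n) p := (smoothExt_evalAt p).continuous
  have h1 : ∫ x : Sph n, ‖evalAt (x : Ambient n) p‖ ^ 2 ∂(surfaceMeasure n) = 0 := by
    rw [← Complex.ofReal_eq_zero, ← h, ← integral_complex_ofReal]
    refine integral_congr_ae (Filter.Eventually.of_forall fun x => ?_)
    simp [evalAt_conjPoly, Complex.conj_mul']
  by_contra hx
  have h2 := (hc.norm.pow 2).integral_pos_of_hasCompactSupport_nonneg_nonzero
    (μ := surfaceMeasure n) (HasCompactSupport.of_compactSpace _) (fun x => sq_nonneg _) (x := x)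
    (pow_ne_zero 2 (norm_ne_zero_iff.mpr hx))
  exact h2.ne' h1

/-! ### Completeness of the spherical harmonics -/

theorem evalAt_rsq (x : Sph n) : evalAt (x : Ambient n) (rsq n) = 1 := by
  rw [← sum_coord_sq x]
  simp [rsq, coord, sq]

/-- A function orthogonal to the spherical harmonics is orthogonal to all polynomials, since
homogeneous polynomials decompose into `r²`-multiples of harmonic ones. -/
theorem integral_evalAt_mul_eq_zero {g : Sph n → ℂ}
    (h : ∀ k, ∀ p ∈ harmPoly n k, ∫ x, evalAt (x : Ambient n) p * g x ∂(surfaceMeasure n) = 0)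
    (hg : Integrable g (surfaceMeasure n)) (p : Poly n) :
    ∫ x, evalAt (x : Ambient n) p * g x ∂(surfaceMeasure n) = 0 := by
  have hint : ∀ p : Poly n,
      Integrable (fun x : Sph n => evalAt (x : Ambient n) p * g x) (surfaceMeasure n) := fun p => by
    obtain ⟨C, hC⟩ := (isCompact_range (smoothExt_evalAt p).continuous).isBounded.exists_norm_le
    exact hg.bdd_mul (smoothExt_evalAt p).continuous.aestronglyMeasurable
      (Filter.Eventually.of_forall fun x => hC _ ⟨x, rfl⟩)
  have hhom : ∀ k, ∀ p : Poly n, p.IsHomogeneous k →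
      ∫ x, evalAt (x : Ambient n) p * g x ∂(surfaceMeasure n) = 0 := by
    intro k
    induction k using Nat.strong_induction_on with
    | _ k ih =>
      intro p hp
      by_cases hk : k < 2
      · exact h k p (by rw [harmPoly_eq_of_lt_two hk]; exact hp)
      · obtain ⟨k, rfl⟩ := Nat.exists_eq_add_of_le' (not_lt.mp hk)
        obtain ⟨q, hq, hpq⟩ := exists_sub_rsq_mul_mem_harmPoly hp
        have h1 := h _ _ hpq
        simp only [evalAt_sub, evalAt_mul, evalAt_rsq, one_mul, sub_mul] at h1
        rw [integral_sub (hint p) (hint q), ih k (by omega) q hq, sub_zero] at h1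
        exact h1
  rw [← sum_homogeneousComponent p]
  simp only [evalAt_sum, Finset.sum_mul]
  rw [integral_finsetSum _ fun i _ => hint _]
  exact Finset.sum_eq_zero fun i _ => hhom i _ (homogeneousComponent_isHomogeneous i p)

/-- The restrictions of polynomials to the sphere, a subalgebra of the continuous functions. -/
def polyAlg (n : ℕ) : StarSubalgebra ℂ C(Sph n, ℂ) where
  carrier := {f | ∃ p : Poly n, ∀ x, f x = evalAt (x : Ambient n) p}
  mul_mem' := by
    rintro f g ⟨p, hp⟩ ⟨q, hq⟩
    exact ⟨p * q, fun x => by simp [hp, hq]⟩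
  add_mem' := by
    rintro f g ⟨p, hp⟩ ⟨q, hq⟩
    exact ⟨p + q, fun x => by simp [hp, hq]⟩
  algebraMap_mem' c := ⟨C c, fun x => by simp⟩
  star_mem' := by
    rintro f ⟨p, hp⟩
    exact ⟨conjPoly p, fun x => by simp [hp, evalAt_conjPoly]⟩

theorem polyAlg_topologicalClosure : (polyAlg n).topologicalClosure = ⊤ := by
  apply ContinuousMap.starSubalgebra_topologicalClosure_eq_top_of_separatesPoints
  intro x y hxy
  have h : ∃ A, (x : Ambient n) A ≠ (y : Ambient n) A := by
    by_contra h
    push Not at h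
    exact hxy (Subtype.ext (PiLp.ext h))
  obtain ⟨A, hA⟩ := h
  refine ⟨fun z => coord A z, ⟨⟨fun z => coord A z, (smoothExt_coord A).continuous⟩,
    ⟨X A, fun z => by simp [coord]⟩, rfl⟩, ?_⟩
  simpa [coord] using hA

theorem ae_eq_zero_of_orthogonal_harmPoly {g : Sph n → ℂ} (hg : Integrable g (surfaceMeasure n))
    (h : ∀ k, ∀ p ∈ harmPoly n k, ∫ x, evalAt (x : Ambient n) p * g x ∂(surfaceMeasure n) = 0) :
    ∀ᵐ x ∂(surfaceMeasure n), g x = 0 := by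
  have hint : ∀ f : C(Sph n, ℂ), Integrable (fun x => f x * g x) (surfaceMeasure n) := fun f =>
    hg.bdd_mul f.continuous.aestronglyMeasurable
      (Filter.Eventually.of_forall fun x => f.norm_coe_le_norm x)
  let L : C(Sph n, ℂ) →L[ℂ] ℂ := LinearMap.mkContinuous
    { toFun := fun f => ∫ x, f x * g x ∂(surfaceMeasure n)
      map_add' := fun f₁ f₂ => by
        simp only [ContinuousMap.add_apply, add_mul]
        exact integral_add (hint f₁) (hint f₂)
      map_smul' := fun c f => by
        simp only [ContinuousMap.smul_apply, smul_eq_mul, mul_assoc, RingHom.id_apply]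
        exact integral_const_mul _ _ }
    (∫ x, ‖g x‖ ∂(surfaceMeasure n)) fun f => by
      change ‖∫ x, f x * g x ∂(surfaceMeasure n)‖ ≤ _
      rw [mul_comm, ← integral_const_mul]
      refine norm_integral_le_of_norm_le (hg.norm.const_mul _)
        (Filter.Eventually.of_forall fun x => ?_)
      rw [norm_mul]
      exact mul_le_mul_of_nonneg_right (f.norm_coe_le_norm x) (norm_nonneg _)
  have hL : ∀ f, L f = 0 := by
    intro f
    have hf : f ∈ (polyAlg n).topologicalClosure := by
      rw [polyAlg_topologicalClosure]; trivial
    have hcl : closure (polyAlg n : Set C(Sph n, ℂ)) ⊆ {f | L f = 0} := by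
      refine closure_minimal ?_ (isClosed_eq L.continuous continuous_const)
      rintro f ⟨p, hp⟩
      change ∫ x, f x * g x ∂(surfaceMeasure n) = 0
      simp only [hp]
      exact integral_evalAt_mul_eq_zero h hg p
    exact hcl hf
  refine ae_eq_zero_of_integral_contMDiff_smul_eq_zero (𝓡 n) hg.locallyIntegrable fun φ hφ _ => ?_
  have := hL ⟨fun x => (φ x : ℂ), Complex.continuous_ofReal.comp hφ.continuous⟩
  simpa [L] using this

/-! ### Eigenfunctions of the Laplace–Beltrami operator -/

theorem integral_mul_sphLap {f g : Sph n → ℂ} (hf : SmoothExt f) (hg : SmoothExt g) :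
    ∫ x, f x * sphLap g x ∂(surfaceMeasure n) =
      -∫ x, ∑ A, tanD A f x * tanD A g x ∂(surfaceMeasure n) := by
  have h1 : ∑ A, ∫ x, tanD A (fun y => f y * tanD A g y) x ∂(surfaceMeasure n) = 0 := by
    simp only [integral_tanD (hf.mul (hg.tanD _))]
    rw [← Finset.mul_sum, ← integral_finsetSum _
      fun A _ => ((smoothExt_coord A).mul (hf.mul (hg.tanD A))).integrable]
    have : ∀ x, ∑ A, coord A x * (f x * tanD A g x) = 0 := fun x => by
      simp only [mul_left_comm _ (f x)]
      rw [← Finset.mul_sum, sum_coord_mul_tanD hg, mul_zero]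
    simp [this]
  rw [← integral_finsetSum _ fun A _ => ((hf.mul (hg.tanD A)).tanD A).integrable] at h1
  rw [eq_neg_iff_add_eq_zero, ← h1, ← integral_add]
  · refine integral_congr_ae (Filter.Eventually.of_forall fun x => ?_)
    simp only [tanD_mul hf (hg.tanD _), sphLap, Finset.mul_sum, Finset.sum_add_distrib]
    congr 1
    exact Finset.sum_congr rfl fun A _ => mul_comm _ _
  · exact (hf.mul (smoothExt_sphLap hg)).integrable
  · exact (smoothExt_sum _ (fun A x => tanD A f x * tanD A g x)
      fun A => (hf.tanD A).mul (hg.tanD A)).integrable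

theorem integral_mul_sphLap_comm {f g : Sph n → ℂ} (hf : SmoothExt f) (hg : SmoothExt g) :
    ∫ x, f x * sphLap g x ∂(surfaceMeasure n) = ∫ x, g x * sphLap f x ∂(surfaceMeasure n) := by
  rw [integral_mul_sphLap hf hg, integral_mul_sphLap hg hf]
  simp only [mul_comm]

/-- The pairing `(p, q) ↦ ∫ p q` on harmonic polynomials of a fixed degree is nondegenerate, so that
integration against any function is represented by a harmonic polynomial. -/
theorem exists_harmPoly_integral_eq {f : Sph n → ℂ} (hf : SmoothExt f) (k : ℕ) :
    ∃ p ∈ harmPoly n k, ∀ q ∈ harmPoly n k,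
      ∫ x, evalAt (x : Ambient n) q * f x ∂(surfaceMeasure n) =
        ∫ x : Sph n, evalAt (x : Ambient n) (q * p) ∂(surfaceMeasure n) := by
  have hint : ∀ (q : Poly n) {f : Sph n → ℂ}, SmoothExt f →
      Integrable (fun x : Sph n => evalAt (x : Ambient n) q * f x) (surfaceMeasure n) :=
    fun q f hf => ((smoothExt_evalAt q).mul hf).integrable
  let ψ : ∀ f : Sph n → ℂ, SmoothExt f → Module.Dual ℂ (harmPoly n k) := fun f hf =>
    { toFun := fun q => ∫ x, evalAt (x : Ambient n) (q : Poly n) * f x ∂(surfaceMeasure n)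
      map_add' := fun q₁ q₂ => by
        simp only [Submodule.coe_add, evalAt_add, add_mul]
        exact integral_add (hint _ hf) (hint _ hf)
      map_smul' := fun c q => by
        simp only [Submodule.coe_smul, evalAt_smul, mul_assoc, RingHom.id_apply, smul_eq_mul]
        exact integral_const_mul _ _ }
  let B : harmPoly n k →ₗ[ℂ] Module.Dual ℂ (harmPoly n k) :=
    { toFun := fun p => ψ _ (smoothExt_evalAt (p : Poly n))
      map_add' := fun p₁ p₂ => by
        ext q
        change ∫ x : Sph n, evalAt (x : Ambient n) (q : Poly n) *
          evalAt (x : Ambient n) (p₁ + p₂ : Poly n) ∂(surfaceMeasure n) = _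
        simp only [evalAt_add, mul_add]
        exact integral_add (hint _ (smoothExt_evalAt _)) (hint _ (smoothExt_evalAt _))
      map_smul' := fun c p => by
        ext q
        change ∫ x : Sph n, evalAt (x : Ambient n) (q : Poly n) *
          evalAt (x : Ambient n) (c • p : Poly n) ∂(surfaceMeasure n) = _
        simp only [evalAt_smul, mul_left_comm _ c]
        exact integral_const_mul _ _ }
  have hinj : Function.Injective B := by
    rw [← LinearMap.ker_eq_bot, LinearMap.ker_eq_bot']
    intro p hp
    apply Subtype.ext
    refine eq_zero_of_integral_conjPoly_mul p.2.1 ?_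
    have h := congrArg (fun L : Module.Dual ℂ (harmPoly n k) =>
      L ⟨conjPoly p, conjPoly_mem_harmPoly p.2⟩) hp
    simp only [evalAt_mul]
    exact h
  have hsurj := (LinearMap.injective_iff_surjective_of_finrank_eq_finrank
    Subspace.dual_finrank_eq.symm).mp hinj
  obtain ⟨p, hp⟩ := hsurj (ψ f hf)
  refine ⟨p, p.2, fun q hq => ?_⟩
  have h := congrArg (fun L : Module.Dual ℂ (harmPoly n k) => L ⟨q, hq⟩) hp
  simp only [evalAt_mul]
  exact h.symm

/-- Eigenfunctions of the sphere Laplacian are spherical harmonics: by self-adjointness they are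
orthogonal to the harmonics of all other degrees. -/
theorem exists_harmPoly_of_sphLap (hn : 2 ≤ n) {k : ℕ} {f : Sph n → ℂ} (hf : SmoothExt f)
    (hk : ∀ x, sphLap f x = -((k : ℂ) * ((k : ℂ) + n - 1)) * f x) :
    ∃ p ∈ harmPoly n k, ∀ x, f x = evalAt (x : Ambient n) p := by
  obtain ⟨p, hp, hpf⟩ := exists_harmPoly_integral_eq hf k
  refine ⟨p, hp, ?_⟩
  have hint : ∀ (q : Poly n),
      Integrable (fun x : Sph n => evalAt (x : Ambient n) q * f x) (surfaceMeasure n) :=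
    fun q => ((smoothExt_evalAt q).mul hf).integrable
  have hcont : Continuous fun x : Sph n => f x - evalAt (x : Ambient n) p :=
    hf.continuous.sub (smoothExt_evalAt p).continuous
  have h := ae_eq_zero_of_orthogonal_harmPoly (integrable_of_continuous hcont) fun l q hq => by
    have e1 : ∫ x, evalAt (x : Ambient n) q * (f x - evalAt (x : Ambient n) p) ∂(surfaceMeasure n) =
        ∫ x, evalAt (x : Ambient n) q * f x ∂(surfaceMeasure n) -
          ∫ x : Sph n, evalAt (x : Ambient n) (q * p) ∂(surfaceMeasure n) := by
      rw [← integral_sub (hint q) (integrable_evalAt _)]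
      simp only [mul_sub, evalAt_mul]
    rw [e1]
    by_cases hkl : l = k
    · subst hkl
      rw [hpf q hq, sub_self]
    · rw [integral_mul_eq_zero_of_ne hn hkl hq hp, sub_zero]
      have h1 := integral_mul_sphLap_comm (smoothExt_evalAt q) hf
      simp only [hk, sphLap_evalAt hq.1, (mem_harmPoly.mp hq).2, evalAt_zero, zero_sub] at h1
      have h2 : ((l : ℂ) - k) * ((n : ℂ) + k + l - 1) *
          ∫ x, evalAt (x : Ambient n) q * f x ∂(surfaceMeasure n) = 0 := by
        have e2 : ∀ x : Sph n, evalAt (x : Ambient n) q * (-((k : ℂ) * ((k : ℂ) + n - 1)) * f x) =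
            -((k : ℂ) * ((k : ℂ) + n - 1)) * (evalAt (x : Ambient n) q * f x) := fun x => by ring
        have e3 : ∀ x : Sph n, f x * -((l : ℂ) * ((l : ℂ) + n - 1) * evalAt (x : Ambient n) q) =
            -((l : ℂ) * ((l : ℂ) + n - 1)) * (evalAt (x : Ambient n) q * f x) := fun x => by ring
        simp only [e2, e3, integral_const_mul] at h1
        linear_combination h1
      have e4 : (l : ℂ) - k ≠ 0 := sub_ne_zero.mpr (by exact_mod_cast hkl)
      simpa [e4, natCast_add_add_sub_one_ne_zero hn k l] using h2
  have h0 : (fun x : Sph n => f x - evalAt (x : Ambient n) p) = fun _ => 0 :=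
    (hcont.ae_eq_iff_eq _ continuous_const).mp h
  exact fun x => sub_eq_zero.mp (congrFun h0 x)

/-! ### Symmetric tensors and homogeneous polynomials -/

/-- The polynomial `a_{A_1 ⋯ A_ℓ} X^{A_1} ⋯ X^{A_ℓ}`. -/
def tensPoly (n ℓ : ℕ) : ((Fin ℓ → Fin (n + 1)) → ℂ) →ₗ[ℂ] Poly n :=
  ∑ A, (LinearMap.proj A).smulRight (∏ k, X (A k))

/-- Invariance of a tensor under permutations of its indices. -/
def IsSymmTens {ℓ : ℕ} (a : (Fin ℓ → Fin (n + 1)) → ℂ) : Prop :=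
  ∀ (σ : Equiv.Perm (Fin ℓ)) (A : Fin ℓ → Fin (n + 1)), a (A ∘ σ) = a A

/-- The symmetric part of a tensor. -/
def symPart {ℓ : ℕ} (a : (Fin ℓ → Fin (n + 1)) → ℂ) (A : Fin ℓ → Fin (n + 1)) : ℂ :=
  ((ℓ.factorial : ℂ))⁻¹ * ∑ σ : Equiv.Perm (Fin ℓ), a (A ∘ σ)

variable {ℓ : ℕ}

theorem tensPoly_apply (a : (Fin ℓ → Fin (n + 1)) → ℂ) :
    tensPoly n ℓ a = ∑ A, a A • ∏ k, X (A k) := by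
  simp [tensPoly]

theorem sum_cons {M : Type*} [AddCommMonoid M] (f : (Fin (ℓ + 1) → Fin (n + 1)) → M) :
    ∑ A, f A = ∑ i, ∑ A : Fin ℓ → Fin (n + 1), f (Fin.cons i A) := by
  rw [← Fintype.sum_prod_type', ← (Fin.consEquiv fun _ => Fin (n + 1)).sum_comp]
  rfl

theorem tensPoly_succ (a : (Fin (ℓ + 1) → Fin (n + 1)) → ℂ) :
    tensPoly n (ℓ + 1) a = ∑ i, X i * tensPoly n ℓ (fun A => a (Fin.cons i A)) := by
  simp only [tensPoly_apply, sum_cons, Fin.prod_univ_succ, Fin.cons_zero, Fin.cons_succ,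
    Finset.mul_sum, mul_smul_comm]

theorem tensPoly_snoc (c : (Fin (ℓ + 1) → Fin (n + 1)) → ℂ) :
    tensPoly n (ℓ + 1) c =
      ∑ B, X B * tensPoly n ℓ (fun A => c (Fin.snoc (α := fun _ => Fin (n + 1)) A B)) := by
  simp only [tensPoly_apply, Finset.mul_sum, mul_smul_comm]
  rw [← Fintype.sum_prod_type', ← (Fin.snocEquiv fun _ => Fin (n + 1)).sum_comp]
  refine Finset.sum_congr rfl fun p _ => ?_
  rw [Fin.prod_univ_castSucc, mul_comm]
  simp [Fin.snocEquiv]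

theorem isHomogeneous_tensPoly (a : (Fin ℓ → Fin (n + 1)) → ℂ) :
    (tensPoly n ℓ a).IsHomogeneous ℓ := by
  induction ℓ with
  | zero =>
    rw [tensPoly_apply]
    refine IsHomogeneous.sum _ _ _ fun A _ => ?_
    simpa using isHomogeneous_smul (a A) (isHomogeneous_one (Fin (n + 1)) ℂ)
  | succ ℓ ih =>
    rw [tensPoly_succ]
    exact isHomogeneous_sum_X_mul fun i => ih _

theorem IsSymmTens.cons {a : (Fin (ℓ + 1) → Fin (n + 1)) → ℂ} (ha : IsSymmTens a)
    (i : Fin (n + 1)) : IsSymmTens fun A : Fin ℓ → Fin (n + 1) => a (Fin.cons i A) := by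
  intro σ A
  refine Eq.trans ?_ (ha (Equiv.Perm.decomposeFin.symm (0, σ)) (Fin.cons i A))
  refine congrArg a ?_
  funext k
  refine Fin.cases ?_ (fun k => ?_) k
  · simp
  · simp [Equiv.Perm.decomposeFin_symm_apply_succ]

theorem IsSymmTens.cons_cons_comm {a : (Fin (ℓ + 2) → Fin (n + 1)) → ℂ} (ha : IsSymmTens a)
    (i j : Fin (n + 1)) (A : Fin ℓ → Fin (n + 1)) :
    a (Fin.cons i (Fin.cons j A : Fin (ℓ + 1) → Fin (n + 1))) =
      a (Fin.cons j (Fin.cons i A : Fin (ℓ + 1) → Fin (n + 1))) := by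
  rw [← ha (Equiv.swap 0 1)]
  congr 1
  funext k
  refine Fin.cases ?_ (fun k => Fin.cases ?_ (fun k => ?_) k) k
  · simp
  · have : (Fin.succ 0 : Fin (ℓ + 2)) = 1 := rfl
    rw [Function.comp_apply, this, Equiv.swap_apply_right]
    rfl
  · have h1 : k.succ.succ ≠ (0 : Fin (ℓ + 2)) := Fin.succ_ne_zero _
    have h2 : k.succ.succ ≠ (1 : Fin (ℓ + 2)) := fun h => by
      have := congrArg Fin.val h
      simp at this
    rw [Function.comp_apply, Equiv.swap_apply_of_ne_of_ne h1 h2]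
    rfl

theorem pderiv_tensPoly : ∀ {ℓ : ℕ} {a : (Fin (ℓ + 1) → Fin (n + 1)) → ℂ}, IsSymmTens a →
    ∀ i, pderiv i (tensPoly n (ℓ + 1) a) =
      ((ℓ : ℂ) + 1) • tensPoly n ℓ (fun A => a (Fin.cons i A)) := by
  intro ℓ
  induction ℓ with
  | zero =>
    intro a _ i
    rw [tensPoly_succ, map_sum]
    have h : ∀ j, pderiv i (X j * tensPoly n 0 fun A => a (Fin.cons j A)) =
        if j = i then tensPoly n 0 (fun A => a (Fin.cons j A)) else 0 := fun j => by
      have h1 := isHomogeneous_tensPoly (n := n) (ℓ := 0) fun A => a (Fin.cons j A)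
      rw [← totalDegree_zero_iff_isHomogeneous, totalDegree_eq_zero_iff_eq_C] at h1
      have h2 : pderiv i (tensPoly n 0 fun A => a (Fin.cons j A)) = 0 := by
        rw [h1, pderiv_C]
      rw [Derivation.leibniz, h2]
      by_cases hij : j = i
      · subst hij; simp
      · simp [hij, pderiv_X]
    simp only [h]
    simp
  | succ ℓ ih =>
    intro a ha i
    rw [tensPoly_succ, map_sum]
    have h : ∀ j, pderiv i (X j * tensPoly n (ℓ + 1) fun A => a (Fin.cons j A)) =
        (if j = i then tensPoly n (ℓ + 1) (fun A => a (Fin.cons j A)) else 0) +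
          ((ℓ : ℂ) + 1) • (X j * tensPoly n ℓ fun A => a (Fin.cons i
            (Fin.cons j A : Fin (ℓ + 1) → Fin (n + 1)))) := fun j => by
      rw [Derivation.leibniz, ih (ha.cons j) i]
      simp only [ha.cons_cons_comm j i]
      by_cases hij : j = i
      · subst hij
        simp [add_comm]
      · simp [hij, pderiv_X]
    simp only [h, Finset.sum_add_distrib, ← Finset.smul_sum]
    rw [← tensPoly_succ (fun A => a (Fin.cons i A))]
    simp only [Finset.sum_ite_eq', Finset.mem_univ, if_true]
    push_cast
    module

theorem eq_zero_of_tensPoly {a : (Fin ℓ → Fin (n + 1)) → ℂ} (ha : IsSymmTens a)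
    (h : tensPoly n ℓ a = 0) : a = 0 := by
  induction ℓ with
  | zero =>
    funext A
    rw [tensPoly_apply] at h
    simp only [Finset.univ_unique, Finset.sum_singleton, Finset.univ_eq_empty,
      Finset.prod_empty, smul_eq_zero, one_ne_zero, or_false] at h
    rw [Subsingleton.elim A, h]
    rfl
  | succ ℓ ih =>
    funext A
    have h1 := pderiv_tensPoly ha (A 0)
    rw [h, map_zero] at h1
    have h2 : ((ℓ : ℂ) + 1) ≠ 0 := by exact_mod_cast Nat.succ_ne_zero ℓ
    have h3 := ih (ha.cons (A 0)) ((smul_eq_zero.mp h1.symm).resolve_left h2)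
    have h4 := congrFun h3 (Fin.tail A)
    simpa [Fin.cons_self_tail] using h4

theorem isSymmTens_symPart (a : (Fin ℓ → Fin (n + 1)) → ℂ) : IsSymmTens (symPart a) := by
  intro τ A
  rw [symPart, symPart, ← Equiv.sum_comp (Equiv.mulLeft τ) fun σ : Equiv.Perm (Fin ℓ) => a (A ∘ σ)]
  rfl

theorem tensPoly_comp_perm (a : (Fin ℓ → Fin (n + 1)) → ℂ) (σ : Equiv.Perm (Fin ℓ)) :
    tensPoly n ℓ (fun A => a (A ∘ σ)) = tensPoly n ℓ a := by
  rw [tensPoly_apply, tensPoly_apply,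
    ← (Equiv.arrowCongr σ.symm (Equiv.refl (Fin (n + 1)))).sum_comp fun A => a A • ∏ k, X (A k)]
  refine Finset.sum_congr rfl fun A _ => ?_
  congr 1
  exact (Equiv.prod_comp σ fun k => (X (A k) : Poly n)).symm

theorem tensPoly_symPart (a : (Fin ℓ → Fin (n + 1)) → ℂ) :
    tensPoly n ℓ (symPart a) = tensPoly n ℓ a := by
  have h : symPart a = ((ℓ.factorial : ℂ))⁻¹ • ∑ σ : Equiv.Perm (Fin ℓ), fun A => a (A ∘ σ) := by
    funext A
    simp [symPart]
  have h1 : (ℓ.factorial : ℂ) ≠ 0 := by exact_mod_cast ℓ.factorial_ne_zero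
  rw [h, map_smul, map_sum]
  simp only [tensPoly_comp_perm, Finset.sum_const, Finset.card_univ, Fintype.card_perm,
    Fintype.card_fin]
  rw [← Nat.cast_smul_eq_nsmul ℂ, smul_smul, inv_mul_cancel₀ h1, one_smul]

/-- The coefficients come from iterating Euler's identity. -/
theorem exists_tensPoly_eq {p : Poly n} (hp : p.IsHomogeneous ℓ) :
    ∃ a, IsSymmTens a ∧ tensPoly n ℓ a = p := by
  suffices h : ∃ a, tensPoly n ℓ a = p by
    obtain ⟨a, ha⟩ := h
    exact ⟨symPart a, isSymmTens_symPart a, by rw [tensPoly_symPart, ha]⟩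
  induction ℓ generalizing p with
  | zero =>
    rw [← totalDegree_zero_iff_isHomogeneous, totalDegree_eq_zero_iff_eq_C] at hp
    refine ⟨fun _ => coeff 0 p, ?_⟩
    rw [tensPoly_apply, hp]
    simp [smul_eq_C_mul]
  | succ ℓ ih =>
    choose a ha using fun i => ih (isHomogeneous_pderiv hp i)
    refine ⟨((ℓ : ℂ) + 1)⁻¹ • fun A => a (A 0) (Fin.tail A), ?_⟩
    rw [map_smul, tensPoly_succ]
    simp only [Fin.cons_zero, Fin.tail_cons, ha]
    rw [← euler, euler_of_isHomogeneous hp, smul_smul]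
    have h2 : ((ℓ : ℂ) + 1) ≠ 0 := by exact_mod_cast Nat.succ_ne_zero ℓ
    push_cast
    rw [inv_mul_cancel₀ h2, one_smul]

theorem lap_tensPoly {a : (Fin (ℓ + 2) → Fin (n + 1)) → ℂ} (ha : IsSymmTens a) :
    lap n (tensPoly n (ℓ + 2) a) = (((ℓ : ℂ) + 2) * ((ℓ : ℂ) + 1)) •
      tensPoly n ℓ (fun A => ∑ i, a (Fin.cons i (Fin.cons i A : Fin (ℓ + 1) → Fin (n + 1)))) := by
  have h : (fun A => ∑ i, a (Fin.cons i (Fin.cons i A : Fin (ℓ + 1) → Fin (n + 1)))) =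
      ∑ i, fun A => a (Fin.cons i (Fin.cons i A : Fin (ℓ + 1) → Fin (n + 1))) := by
    funext A; simp
  rw [h, map_sum, Finset.smul_sum, lap_apply]
  refine Finset.sum_congr rfl fun i _ => ?_
  rw [pderiv_tensPoly ha, Derivation.map_smul, pderiv_tensPoly (ha.cons i), smul_smul]
  congr 1
  push_cast
  ring

/-! ### Admissible tensors and polynomial vector fields -/

/-- The polynomial vector field `b_{A_1 ⋯ A_ℓ ; B} X^{A_1} ⋯ X^{A_ℓ}` of a tensor `b`. -/
def tensField (b : Tens n ℓ) (B : Fin (n + 1)) : Poly n := tensPoly n ℓ fun A => b A B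

theorem isSymm_iff {b : Tens n ℓ} : IsSymm b ↔ ∀ B, IsSymmTens fun A => b A B :=
  ⟨fun h B σ A => h σ A B, fun h σ A B => h B σ A⟩

theorem exists_perm_zero_one {j k : Fin (ℓ + 2)} (hjk : j ≠ k) :
    ∃ σ : Equiv.Perm (Fin (ℓ + 2)), σ 0 = j ∧ σ 1 = k := by
  have h01 : (0 : Fin (ℓ + 2)) ≠ 1 := by simp
  refine ⟨Equiv.swap (Equiv.swap 0 j 1) k * Equiv.swap 0 j, ?_, ?_⟩
  · rw [Equiv.Perm.mul_apply, Equiv.swap_apply_left, Equiv.swap_apply_of_ne_of_ne ?_ hjk]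
    intro h
    have := congrArg (Equiv.swap 0 j) h
    rw [Equiv.swap_apply_right, Equiv.swap_apply_self] at this
    exact h01 this
  · rw [Equiv.Perm.mul_apply, Equiv.swap_apply_left]

theorem isTraceless_iff {b : Tens n ℓ} (hb : IsSymm b) :
    IsTraceless b ↔ ∀ B, lap n (tensField b B) = 0 := by
  match ℓ, b, hb with
  | 0, b, hb =>
    refine ⟨fun _ B => ?_, fun _ j => j.elim0⟩
    have h : tensField b B ∈ harmPoly n 0 := by
      rw [harmPoly_eq_of_lt_two (by norm_num)]
      exact isHomogeneous_tensPoly _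
    exact h.2
  | 1, b, hb =>
    refine ⟨fun _ B => ?_, fun _ j k hjk => absurd (Subsingleton.elim j k) hjk⟩
    have h : tensField b B ∈ harmPoly n 1 := by
      rw [harmPoly_eq_of_lt_two (by norm_num)]
      exact isHomogeneous_tensPoly _
    exact h.2
  | ℓ + 2, b, hb =>
    have hs := isSymm_iff.mp hb
    have hc : (((ℓ : ℂ) + 2) * ((ℓ : ℂ) + 1)) ≠ 0 := by
      have : (((ℓ : ℝ) + 2) * ((ℓ : ℝ) + 1)) ≠ 0 := by positivity
      exact_mod_cast this
    have h01 : (0 : Fin (ℓ + 2)) ≠ 1 := by simp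
    have key : ∀ {j k : Fin (ℓ + 2)} (σ : Equiv.Perm (Fin (ℓ + 2))), σ 0 = j → σ 1 = k →
        ∀ (A : Fin (ℓ + 2) → Fin (n + 1)) (i : Fin (n + 1)),
          Function.update (Function.update A j i) k i ∘ σ =
            Fin.cons i (Fin.cons i (fun m => A (σ m.succ.succ)) : Fin (ℓ + 1) → Fin (n + 1)) := by
      intro j k σ h0 h1 A i
      funext m
      refine Fin.cases ?_ (fun m => Fin.cases ?_ (fun m => ?_) m) m
      · have hjk : j ≠ k := by rw [← h0, ← h1]; exact σ.injective.ne h01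
        rw [Function.comp_apply, h0, Function.update_of_ne hjk, Function.update_self,
          Fin.cons_zero]
      · rw [Function.comp_apply, show (Fin.succ 0 : Fin (ℓ + 2)) = 1 from rfl, h1,
          Function.update_self]
        rfl
      · have e0 : m.succ.succ ≠ (0 : Fin (ℓ + 2)) := Fin.succ_ne_zero _
        have e1 : m.succ.succ ≠ (1 : Fin (ℓ + 2)) := fun h => by
          have := congrArg Fin.val h
          simp at this
        have f0 : σ m.succ.succ ≠ j := by rw [← h0]; exact σ.injective.ne e0
        have f1 : σ m.succ.succ ≠ k := by rw [← h1]; exact σ.injective.ne e1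
        rw [Function.comp_apply, Function.update_of_ne f1, Function.update_of_ne f0]
        rfl
    constructor
    · intro h B
      rw [tensField, lap_tensPoly (hs B)]
      have : (fun A => ∑ i, b (Fin.cons i (Fin.cons i A : Fin (ℓ + 1) → Fin (n + 1))) B) = 0 := by
        funext A
        have h1 := h 0 1 h01 (Fin.cons 0 (Fin.cons 0 A : Fin (ℓ + 1) → Fin (n + 1))) B
        rw [Pi.zero_apply, ← h1]
        refine Finset.sum_congr rfl fun i _ => ?_
        have h2 := key (Equiv.refl _) rfl rfl
          (Fin.cons 0 (Fin.cons 0 A : Fin (ℓ + 1) → Fin (n + 1))) i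
        rw [Equiv.coe_refl, Function.comp_id, id, id] at h2
        rw [h2]
        rfl
      rw [this, map_zero, smul_zero]
    · intro h j k hjk A B
      obtain ⟨σ, h0, h1⟩ := exists_perm_zero_one hjk
      have h2 := h B
      rw [tensField, lap_tensPoly (hs B)] at h2
      have h3 := eq_zero_of_tensPoly (fun τ A => ?_) ((smul_eq_zero.mp h2).resolve_left hc)
      · have h4 := congrFun h3 fun m => A (σ m.succ.succ)
        rw [Pi.zero_apply] at h4
        rw [← h4]
        refine Finset.sum_congr rfl fun i _ => ?_
        rw [← key σ h0 h1, hb σ]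
      · exact Finset.sum_congr rfl fun i _ => ((hs B).cons i).cons i τ A

theorem fullSymm_eq_zero_iff {b : Tens n ℓ} :
    (∀ A, fullSymm b A = 0) ↔ ∑ B, X B * tensField b B = 0 := by
  let c : (Fin (ℓ + 1) → Fin (n + 1)) → ℂ := fun A => b (fun k => A k.castSucc) (A (Fin.last ℓ))
  have h1 : tensPoly n (ℓ + 1) c = ∑ B, X B * tensField b B := by
    rw [tensPoly_snoc]
    simp [c, tensField]
  have h2 : fullSymm b = symPart c := rfl
  rw [← h1, ← tensPoly_symPart]
  constructor
  · intro h
    rw [show symPart c = 0 from funext fun A => by rw [← h2]; exact h A, map_zero]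
  · intro h A
    rw [h2, eq_zero_of_tensPoly (isSymmTens_symPart c) h]
    rfl

theorem isAdmissible_iff {b : Tens n ℓ} : IsAdmissible b ↔ IsSymm b ∧ tensField b ∈ tangHarm n ℓ := by
  constructor
  · intro h
    exact ⟨h.symm, fun B => ⟨isHomogeneous_tensPoly _, (isTraceless_iff h.symm).mp h.traceless B⟩,
      fullSymm_eq_zero_iff.mp h.fullSymm_eq_zero⟩
  · rintro ⟨h1, h2, h3⟩
    exact ⟨h1, (isTraceless_iff h1).mpr fun B => (h2 B).2, fullSymm_eq_zero_iff.mpr h3⟩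

theorem tensField_injective {b b' : Tens n ℓ} (hb : IsSymm b) (hb' : IsSymm b')
    (h : tensField b = tensField b') : b = b' := by
  funext A B
  have h1 := congrFun h B
  rw [tensField, tensField, ← sub_eq_zero, ← map_sub] at h1
  have h2 := eq_zero_of_tensPoly (fun σ A => ?_) h1
  · exact sub_eq_zero.mp (congrFun h2 A)
  · simp only [Pi.sub_apply, hb σ A B, hb' σ A B]

theorem exists_tensField_eq {u : Fin (n + 1) → Poly n} (hu : ∀ B, (u B).IsHomogeneous ℓ) :
    ∃ b : Tens n ℓ, IsSymm b ∧ tensField b = u := by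
  choose a ha hau using fun B => exists_tensPoly_eq (hu B)
  exact ⟨fun A B => a B A, isSymm_iff.mpr ha, funext hau⟩

/-! ### Surface area and the pairing of tensors -/

theorem surfaceMeasure_real_univ (n : ℕ) : (surfaceMeasure n).real Set.univ = normConst n 0 := by
  have hpos : (0 : ℝ) < ((n : ℝ) + 1) / 2 := by positivity
  rw [surfaceMeasure, Measure.toSphere_real_apply_univ, measureReal_def,
    EuclideanSpace.volume_ball]
  rw [ENNReal.toReal_mul, ENNReal.toReal_ofReal (by positivity)]
  simp only [Fintype.card_fin, finrank_euclideanSpace, normConst, Nat.factorial_zero, pow_zero,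
    Nat.cast_one, ENNReal.ofReal_one, one_pow, ENNReal.toReal_one, CharP.cast_eq_zero, add_zero]
  have h1 : √Real.pi ^ (n + 1) = Real.pi ^ (((n : ℝ) + 1) / 2) := by
    rw [Real.sqrt_eq_rpow, ← Real.rpow_natCast, ← Real.rpow_mul Real.pi_pos.le]
    congr 1
    push_cast
    ring
  push_cast
  rw [h1, Real.Gamma_add_one hpos.ne']
  have h2 := (Real.Gamma_pos_of_pos hpos).ne'
  field_simp

theorem normConst_succ (n ℓ : ℕ) :
    ((n : ℝ) + 2 * ℓ + 1) * normConst n (ℓ + 1) = ((ℓ : ℝ) + 1) * normConst n ℓ := by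
  have hpos : (0 : ℝ) < ((n : ℝ) + 1) / 2 + ℓ := by positivity
  have h := Real.Gamma_add_one hpos.ne'
  have h2 := (Real.Gamma_pos_of_pos hpos).ne'
  have h3 : ((n : ℝ) + 1) / 2 + ((ℓ + 1 : ℕ) : ℝ) = ((n : ℝ) + 1) / 2 + ℓ + 1 := by push_cast; ring
  rw [normConst, normConst, h3, h, Nat.factorial_succ, pow_succ]
  push_cast
  have h4 : ((n : ℝ) + 1 + 2 * ℓ) ≠ 0 := by positivity
  field_simp
  ring

/-- Differentiation removes one index from both tensors, so that integration by parts
computes the `L²` pairing by induction on the number of indices. -/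
theorem integral_tensPoly_mul {a a' : (Fin ℓ → Fin (n + 1)) → ℂ} (ha : IsSymmTens a)
    (ha' : IsSymmTens a') (hlap : tensPoly n ℓ a ∈ harmPoly n ℓ) :
    ∫ x : Sph n, evalAt (x : Ambient n) (tensPoly n ℓ a * tensPoly n ℓ a') ∂(surfaceMeasure n) =
      normConst n ℓ * ∑ A, a A * a' A := by
  induction ℓ with
  | zero =>
    rw [← surfaceMeasure_real_univ]
    simp [tensPoly_apply, mul_comm]
  | succ ℓ ih =>
    have h1 := sum_integral_pderiv_mul_pderiv hlap (isHomogeneous_tensPoly a')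
    have h2 : ∀ i, tensPoly n ℓ (fun A => a (Fin.cons i A)) ∈ harmPoly n ℓ := fun i => by
      have h3 := harmPoly_pderiv hlap i
      rw [pderiv_tensPoly ha] at h3
      exact ((harmPoly n ℓ).smul_mem_iff (by exact_mod_cast Nat.succ_ne_zero ℓ)).mp h3
    have h4 : ∀ i, ∫ x : Sph n, evalAt (x : Ambient n)
        (pderiv i (tensPoly n (ℓ + 1) a) * pderiv i (tensPoly n (ℓ + 1) a')) ∂(surfaceMeasure n) =
        ((ℓ : ℂ) + 1) ^ 2 * (normConst n ℓ *
          ∑ A : Fin ℓ → Fin (n + 1), a (Fin.cons i A) * a' (Fin.cons i A)) := fun i => by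
      rw [← ih (ha.cons i) (ha'.cons i) (h2 i), ← integral_const_mul]
      refine integral_congr_ae (Filter.Eventually.of_forall fun x => ?_)
      simp only [pderiv_tensPoly ha, pderiv_tensPoly ha', evalAt_mul, evalAt_smul]
      ring
    simp only [h4] at h1
    rw [← Finset.mul_sum, ← Finset.mul_sum, ← sum_cons fun A => a A * a' A] at h1
    have h5 := congrArg Complex.ofReal (normConst_succ n ℓ)
    have e1 : ((ℓ : ℂ) + 1) * ((n : ℂ) + 2 * ℓ + 1) ≠ 0 := by
      have : ((ℓ : ℝ) + 1) * ((n : ℝ) + 2 * ℓ + 1) ≠ 0 := by positivity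
      exact_mod_cast this
    apply mul_left_cancel₀ e1
    push_cast at h1 h5
    linear_combination (-1 : ℂ) * h1 - ((ℓ : ℂ) + 1) * (∑ A, a A * a' A) * h5

/-! ### Harmonic vectors as polynomial vector fields -/

/-- The restriction of a polynomial vector field to the sphere. -/
def polyField (u : Fin (n + 1) → Poly n) (x : Sph n) : Vec n :=
  WithLp.toLp 2 fun A => evalAt (x : Ambient n) (u A)

@[simp] theorem polyField_apply (u : Fin (n + 1) → Poly n) (x : Sph n) (A : Fin (n + 1)) :
    polyField u x A = evalAt (x : Ambient n) (u A) := rfl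

theorem contMDiff_polyField (u : Fin (n + 1) → Poly n) :
    ContMDiff (𝓡 n) 𝓘(ℝ, Vec n) ∞ (polyField u) := by
  have h : ContDiff ℝ ∞ (fun y : Ambient n =>
      (WithLp.toLp 2 fun A => evalAt y (u A) : Vec n)) := by
    have h1 : ContDiff ℝ ∞ (fun y : Ambient n => fun A => evalAt y (u A)) :=
      contDiff_pi.mpr fun A => contDiff_evalAt (u A)
    exact ((PiLp.continuousLinearEquiv 2 ℂ (fun _ : Fin (n + 1) => ℂ)).symm.toContinuousLinearMap
      |>.restrictScalars ℝ).contDiff.comp h1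
  have := Fact.mk (@finrank_euclideanSpace_fin ℝ _ (n + 1))
  exact h.contMDiff.comp contMDiff_coe_sphere

theorem isTangent_polyField {u : Fin (n + 1) → Poly n} (hu : ∑ B, X B * u B = 0) :
    IsTangent (polyField u) := by
  intro x
  have h := congrArg (evalAt (x : Ambient n)) hu
  simpa [coord] using h

theorem divergence_polyField {u : Fin (n + 1) → Poly n} (hu : IsTangent (polyField u))
    (x : Sph n) : divergence (polyField u) x =
      evalAt (x : Ambient n) (∑ A, pderiv A (u A) - ∑ A, X A * euler (u A)) := by
  rw [divergence_eq (fun B => smoothExt_evalAt (u B)) hu]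
  simp only [polyField_apply, tanD_evalAt]
  rw [← evalAt_sum, Finset.sum_sub_distrib]

theorem eigenvalue_cast (n k : ℕ) :
    ((eigenvalue n k : ℝ) : ℂ) = (k : ℂ) * ((k : ℂ) + n - 1) - 1 := by
  simp [eigenvalue]

/-- For tangent homogeneous fields the equation on the sphere is Laplace's equation in the ambient
space. -/
theorem laplacian_polyField {u : Fin (n + 1) → Poly n} {k : ℕ} (hu : ∀ B, (u B).IsHomogeneous k)
    (hT : ∑ B, X B * u B = 0) (x : Sph n) (C : Fin (n + 1))
    (hdiv : divergence (polyField u) x = 0) :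
    laplacian (polyField u) C x + (eigenvalue n k : ℂ) * polyField u x C =
      evalAt (x : Ambient n) (lap n (u C)) := by
  rw [laplacian_eq (fun B => smoothExt_evalAt (u B)) (isTangent_polyField hT), hdiv,
    eigenvalue_cast]
  simp only [polyField_apply]
  rw [sphLap_evalAt (hu C)]
  ring

theorem isHarmonicVector_polyField {u : Fin (n + 1) → Poly n} {k : ℕ} (hu : u ∈ tangHarm n k) :
    IsHarmonicVector (eigenvalue n k) (polyField u) := by
  have hlap : ∀ B, lap n (u B) = 0 := fun B => (hu.1 B).2
  have hdiv : ∀ x, divergence (polyField u) x = 0 := fun x => by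
    rw [divergence_polyField (isTangent_polyField hu.2), sum_pderiv_eq_zero_of_lap hlap hu.2]
    simp only [fun A => euler_of_isHomogeneous (hu.1 A).1, mul_smul_comm, ← Finset.smul_sum, hu.2]
    simp
  refine ⟨contMDiff_polyField u, isTangent_polyField hu.2, fun x C => ?_, hdiv⟩
  rw [laplacian_polyField (fun B => (hu.1 B).1) hu.2 x C (hdiv x), hlap, evalAt_zero]

/-- Harmonic vectors have spherical harmonics as Cartesian components. -/
theorem IsHarmonicVector.exists_polyField (hn : 2 ≤ n) {k : ℕ} {V : Sph n → Vec n}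
    (hV : IsHarmonicVector (eigenvalue n k) V) : ∃ u ∈ tangHarm n k, V = polyField u := by
  have h : ∀ B, ∃ p ∈ harmPoly n k, ∀ x, V x B = evalAt (x : Ambient n) p := fun B => by
    refine exists_harmPoly_of_sphLap hn (hV.smoothExt B) fun x => ?_
    have h1 := hV.eigen x B
    rw [laplacian_eq hV.smoothExt hV.tangent, hV.divFree x, eigenvalue_cast] at h1
    linear_combination h1
  choose u hu hVu using h
  have hVu' : V = polyField u := funext fun x => PiLp.ext fun B => hVu B x
  refine ⟨u, ⟨hu, ?_⟩, hVu'⟩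
  refine eq_zero_of_evalAt_sphere (isHomogeneous_sum_X_mul fun B => (hu B).1) fun x => ?_
  have h2 := hV.tangent x
  simp only [hVu] at h2
  simpa [coord] using h2

theorem polyField_injective {k : ℕ} {u v : Fin (n + 1) → Poly n}
    (hu : ∀ B, (u B).IsHomogeneous k) (hv : ∀ B, (v B).IsHomogeneous k)
    (h : polyField u = polyField v) : u = v := by
  funext B
  rw [← sub_eq_zero]
  refine eq_zero_of_evalAt_sphere ((hu B).sub (hv B)) fun x => ?_
  have h1 := congrArg (fun V : Sph n → Vec n => V x B) h
  rw [evalAt_sub, sub_eq_zero]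
  exact h1

theorem finrank_harmonicSpace (hn : 2 ≤ n) (k : ℕ) :
    Module.finrank ℂ (harmonicSpace n (eigenvalue n k)) = Module.finrank ℂ (tangHarm n k) := by
  let L : tangHarm n k →ₗ[ℂ] harmonicSpace n (eigenvalue n k) :=
    { toFun := fun u => ⟨polyField u, isHarmonicVector_polyField u.2⟩
      map_add' := fun u v => by
        apply Subtype.ext
        funext x
        ext A
        simp
      map_smul' := fun c u => by
        apply Subtype.ext
        funext x
        ext A
        simp }
  have hL : Function.Bijective L := by
    constructor
    · intro u v h
      exact Subtype.ext (polyField_injective (fun B => (u.2.1 B).1) (fun B => (v.2.1 B).1)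
        (congrArg Subtype.val h))
    · rintro ⟨V, hV⟩
      obtain ⟨u, hu, rfl⟩ := IsHarmonicVector.exists_polyField hn hV
      exact ⟨⟨u, hu⟩, rfl⟩
  exact (LinearEquiv.ofBijective L hL).finrank_eq.symm

/-! ### The fields `V_b` -/

theorem evalAt_tensPoly (x : Sph n) (a : (Fin ℓ → Fin (n + 1)) → ℂ) :
    evalAt (x : Ambient n) (tensPoly n ℓ a) = ∑ A, a A * ∏ k, coord (A k) x := by
  rw [tensPoly_apply, evalAt_sum]
  refine Finset.sum_congr rfl fun A _ => ?_
  rw [evalAt_smul]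
  congr 1
  rw [evalAt, map_prod]
  simp [coord]

/-- `V_b` is the tangential part of the polynomial vector field of `b`. -/
theorem vecField_eq (b : Tens n ℓ) :
    vecField b = polyField fun A => tensField b A - X A * ∑ B, X B * tensField b B := by
  funext x
  ext A
  have h1 : vecField b x A =
      ∑ B, tanProj x A B * evalAt (x : Ambient n) (tensField b B) := by
    simp only [vecField, tensField, evalAt_tensPoly, tanD_coord, Finset.mul_sum]
    rw [Finset.sum_comm]
    exact Finset.sum_congr rfl fun B _ => Finset.sum_congr rfl fun A' _ => by ring
  rw [h1, sum_tanProj_mul]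
  simp [coord]

theorem vecField_eq_of_tangent {b : Tens n ℓ} (hb : ∑ B, X B * tensField b B = 0) :
    vecField b = polyField (tensField b) := by
  rw [vecField_eq, hb]
  simp

theorem IsAdmissible.vecField_eq {b : Tens n ℓ} (hb : IsAdmissible b) :
    vecField b = polyField (tensField b) :=
  vecField_eq_of_tangent (isAdmissible_iff.mp hb).2.2

theorem IsAdmissible.isHarmonicVector {b : Tens n ℓ} (hb : IsAdmissible b) :
    IsHarmonicVector (eigenvalue n ℓ) (vecField b) := by
  rw [hb.vecField_eq]
  exact isHarmonicVector_polyField (isAdmissible_iff.mp hb).2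

theorem exists_isAdmissible {u : Fin (n + 1) → Poly n} (hu : u ∈ tangHarm n ℓ) :
    ∃ b : Tens n ℓ, IsAdmissible b ∧ tensField b = u := by
  obtain ⟨b, hb, hbu⟩ := exists_tensField_eq fun B => (hu.1 B).1
  exact ⟨b, isAdmissible_iff.mpr ⟨hb, by rwa [hbu]⟩, hbu⟩

theorem isHarmonicVector_iff_existsUnique (hn : 2 ≤ n) (V : Sph n → Vec n) :
    IsHarmonicVector (eigenvalue n ℓ) V ↔ ∃! b : Tens n ℓ, IsAdmissible b ∧ V = vecField b := by
  constructor
  · intro hV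
    obtain ⟨u, hu, rfl⟩ := hV.exists_polyField hn
    obtain ⟨b, hb, rfl⟩ := exists_isAdmissible hu
    refine ⟨b, ⟨hb, hb.vecField_eq.symm⟩, ?_⟩
    rintro b' ⟨hb', h⟩
    rw [hb'.vecField_eq] at h
    exact tensField_injective hb'.symm hb.symm (polyField_injective
      (fun _ => isHomogeneous_tensPoly _) (fun _ => isHomogeneous_tensPoly _) h).symm
  · rintro ⟨b, ⟨hb, rfl⟩, -⟩
    exact hb.isHarmonicVector

/-- A vanishing divergence of `V_b` reads `r² h = (n + ℓ) s` for the ambient divergence `h` and the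
radial component `s` of the polynomial field; applying the Laplacian yields `(ℓ - 1) h = 0`. -/
theorem isHarmonicVector_vecField_iff_fullSymm (hℓ : 1 ≤ ℓ) {b : Tens n ℓ} (hs : IsSymm b)
    (ht : IsTraceless b) (h1 : ℓ = 1 → ∑ i, b (fun _ => i) i = 0) :
    IsHarmonicVector (eigenvalue n ℓ) (vecField b) ↔ ∀ A, fullSymm b A = 0 := by
  refine ⟨fun hV => ?_, fun h => IsAdmissible.isHarmonicVector ⟨hs, ht, h⟩⟩
  obtain ⟨k, rfl⟩ := Nat.exists_eq_add_of_le' hℓ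
  rw [fullSymm_eq_zero_iff]
  have hlap := (isTraceless_iff hs).mp ht
  have hhom : ∀ B, (tensField b B).IsHomogeneous (k + 1) := fun B => isHomogeneous_tensPoly _
  set u := tensField b with hu
  set s := ∑ B, X B * u B with hsdef
  set h := ∑ B, pderiv B (u B) with hdef
  have hshom : s.IsHomogeneous (k + 2) := isHomogeneous_sum_X_mul hhom
  have hhhom : h.IsHomogeneous k := IsHomogeneous.sum _ _ _ fun B _ => isHomogeneous_pderiv (hhom B) B
  have hlaps : lap n s = (2 : ℂ) • h := by
    rw [hsdef, lap_sum_X_mul, smul_eq_C_mul, map_ofNat]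
    simp [hlap, hdef]
  have hlaph : lap n h = 0 := by
    simp [hdef, lap_pderiv, hlap]
  have e0 : ((n : ℂ) + k + 1) ≠ 0 := by exact_mod_cast Nat.succ_ne_zero (n + k)
  have hdiv : rsq n * h - ((n : ℂ) + k + 1) • s = 0 := by
    have hh : (rsq n * h).IsHomogeneous (k + 2) := by
      rw [add_comm k 2]; exact isHomogeneous_rsq.mul hhhom
    refine eq_zero_of_evalAt_sphere (hh.sub (isHomogeneous_smul _ hshom)) fun x => ?_
    have hd := hV.divFree x
    have hT := hV.tangent
    have hb : vecField b = polyField fun A => u A - X A * s := vecField_eq b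
    rw [hb] at hd hT
    rw [divergence_polyField hT] at hd
    have e1 : ∀ A, pderiv A (u A - X A * s) = pderiv A (u A) - (s + X A * pderiv A s) := fun A => by
      simp only [map_sub, Derivation.leibniz, smul_eq_mul, pderiv_X_self]
      ring
    have e2 : ∀ A, X A * euler (u A - X A * s) =
        ((k : ℂ) + 1) • (X A * u A) - ((k : ℂ) + 3) • (X A ^ 2 * s) := fun A => by
      have e3 : euler (u A - X A * s) = euler (u A) - euler (X A * s) := by
        simp only [euler, map_sub, mul_sub, Finset.sum_sub_distrib]
      have e4 : (1 + (k + 2) : ℕ) = ((k : ℂ) + 3) := by push_cast; ring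
      rw [e3, euler_of_isHomogeneous (hhom A),
        euler_of_isHomogeneous ((isHomogeneous_X ℂ A).mul hshom), e4, mul_sub, mul_smul_comm,
        mul_smul_comm]
      push_cast
      congr 2
      ring
    simp only [e1, e2, Finset.sum_sub_distrib, Finset.sum_add_distrib, ← Finset.smul_sum,
      ← Finset.sum_mul] at hd
    rw [← hdef, ← hsdef, ← euler, euler_of_isHomogeneous hshom, ← rsq] at hd
    simp only [evalAt_sub, evalAt_add, evalAt_smul, evalAt_mul, evalAt_rsq, one_mul,
      Finset.sum_const, Finset.card_univ, Fintype.card_fin] at hd ⊢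
    rw [← Nat.cast_smul_eq_nsmul ℂ, evalAt_smul] at hd
    push_cast at hd
    linear_combination hd
  have hkh : ((2 : ℂ) * k) • h = 0 := by
    have h2 := congrArg (lap n) hdiv
    rw [map_sub, map_smul, lap_rsq_mul, hlaps, hlaph, euler_of_isHomogeneous hhhom, map_zero,
      mul_zero, add_zero] at h2
    rw [← h2]
    module
  have hh0 : h = 0 := by
    rcases Nat.eq_zero_or_pos k with rfl | hk
    · have h3 := h1 rfl
      have h4 : ∀ B, pderiv B (u B) = C (b (fun _ => B) B) := fun B => by
        rw [hu, tensField, pderiv_tensPoly (isSymm_iff.mp hs B), tensPoly_apply]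
        simp only [Finset.univ_unique, Finset.sum_singleton, Finset.univ_eq_empty,
          Finset.prod_empty, smul_eq_C_mul, mul_one, Nat.cast_zero, zero_add, map_one, one_mul]
        congr 2
        funext j
        rw [show j = 0 from Fin.fin_one_eq_zero j]
        rfl
      rw [hdef]
      simp only [h4]
      rw [← map_sum, h3, map_zero]
    · refine (smul_eq_zero.mp hkh).resolve_left (mul_ne_zero two_ne_zero ?_)
      exact_mod_cast hk.ne'
  rw [hh0, mul_zero, zero_sub, neg_eq_zero] at hdiv
  exact (smul_eq_zero.mp hdiv).resolve_left e0

theorem isHarmonicVector_vecField_iff_isTraceless {b : Tens n ℓ} (hs : IsSymm b)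
    (hf : ∀ A, fullSymm b A = 0) :
    IsHarmonicVector (eigenvalue n ℓ) (vecField b) ↔ IsTraceless b := by
  refine ⟨fun hV => ?_, fun h => IsAdmissible.isHarmonicVector ⟨hs, h, hf⟩⟩
  have hT := fullSymm_eq_zero_iff.mp hf
  have hhom : ∀ B, (tensField b B).IsHomogeneous ℓ := fun B => isHomogeneous_tensPoly _
  rw [vecField_eq_of_tangent hT] at hV
  refine (isTraceless_iff hs).mpr fun B => eq_zero_of_evalAt_sphere (isHomogeneous_lap (hhom B))
    fun x => ?_
  rw [← laplacian_polyField hhom hT x B (hV.divFree x)]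
  exact hV.eigen x B

/-! ### Inner products of the fields `V_b` -/

theorem innerProd_polyField (u v : Fin (n + 1) → Poly n) :
    innerProd (polyField u) (polyField v) =
      ∑ A, ∫ x : Sph n, evalAt (x : Ambient n) (conjPoly (u A) * v A) ∂(surfaceMeasure n) := by
  rw [innerProd, ← integral_finsetSum _ fun A _ => integrable_evalAt _]
  simp [evalAt_conjPoly]

theorem innerProd_vecField_of_ne (hn : 2 ≤ n) {ℓ' : ℕ} (hne : ℓ ≠ ℓ') {b : Tens n ℓ}
    {b' : Tens n ℓ'} (hb : IsAdmissible b) (hb' : IsAdmissible b') :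
    innerProd (vecField b) (vecField b') = 0 := by
  rw [hb.vecField_eq, hb'.vecField_eq, innerProd_polyField]
  exact Finset.sum_eq_zero fun A _ => integral_mul_eq_zero_of_ne hn hne
    (conjPoly_mem_harmPoly ((isAdmissible_iff.mp hb).2.1 A)) ((isAdmissible_iff.mp hb').2.1 A)

theorem conjPoly_tensPoly (a : (Fin ℓ → Fin (n + 1)) → ℂ) :
    conjPoly (tensPoly n ℓ a) = tensPoly n ℓ (fun A => conj (a A)) := by
  simp only [tensPoly_apply, conjPoly, map_sum, smul_eq_C_mul, map_mul, map_C, map_prod, map_X]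

theorem innerProd_vecField {b b' : Tens n ℓ} (hb : IsAdmissible b) (hb' : IsAdmissible b') :
    innerProd (vecField b) (vecField b') = (normConst n ℓ : ℂ) * tensDot b b' := by
  rw [hb.vecField_eq, hb'.vecField_eq, innerProd_polyField, tensDot, Finset.sum_comm,
    Finset.mul_sum]
  refine Finset.sum_congr rfl fun B _ => ?_
  have h := conjPoly_mem_harmPoly ((isAdmissible_iff.mp hb).2.1 B)
  rw [tensField, conjPoly_tensPoly] at h
  rw [tensField, tensField, conjPoly_tensPoly]
  exact integral_tensPoly_mul (fun σ A => by simp only [hb.symm σ A B])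
    (fun σ A => hb'.symm σ A B) h

/-! ### Completeness of the fields `V_b` -/

theorem memLp_of_continuous {W : Sph n → Vec n} (hW : Continuous W) :
    MemLp W 2 (surfaceMeasure n) := by
  obtain ⟨C, hC⟩ := (isCompact_range hW).isBounded.exists_norm_le
  exact MemLp.of_bound hW.aestronglyMeasurable C (Filter.Eventually.of_forall fun x => hC _ ⟨x, rfl⟩)

theorem integrable_coe_apply (v : L2Vec n) (A : Fin (n + 1)) :
    Integrable (fun x => v x A) (surfaceMeasure n) :=
  (EuclideanSpace.proj (𝕜 := ℂ) A : Vec n →L[ℂ] ℂ).integrable_comp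
    ((Lp.memLp v).integrable (by norm_num))

theorem integrable_mul_coe_apply {f : Sph n → ℂ} (hf : Continuous f) (v : L2Vec n)
    (A : Fin (n + 1)) : Integrable (fun x => f x * v x A) (surfaceMeasure n) := by
  obtain ⟨C, hC⟩ := (isCompact_range hf).isBounded.exists_norm_le
  exact (integrable_coe_apply v A).bdd_mul hf.aestronglyMeasurable
    (Filter.Eventually.of_forall fun x => hC _ ⟨x, rfl⟩)

theorem inner_eq_integral {W : Sph n → Vec n} {w : L2Vec n} (hw : w =ᵐ[surfaceMeasure n] W)
    (v : L2Vec n) :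
    inner ℂ w v = ∫ x, ∑ A, conj (W x A) * v x A ∂(surfaceMeasure n) := by
  rw [L2.inner_def]
  refine integral_congr_ae ?_
  filter_upwards [hw] with x hx
  rw [hx, PiLp.inner_apply]
  simp [mul_comm]

/-- The normal field `x ↦ x ψ(x)` of a polynomial `ψ`. -/
def normalField (p : Poly n) : Sph n → Vec n := polyField fun A => X A * p

/-- The complex conjugate of the gradient of `φ`. -/
def conjGradient (φ : Sph n → ℂ) (x : Sph n) : Vec n := WithLp.toLp 2 fun A => conj (tanD A φ x)

/-- The fields against which tangent divergence-free fields are characterised by orthogonality. -/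
def testFields (n : ℕ) : Set (L2Vec n) :=
  {w | (∃ p : Poly n, w =ᵐ[surfaceMeasure n] normalField p) ∨
    ∃ φ : Sph n → ℂ, ContMDiff (𝓡 n) 𝓘(ℝ, ℂ) ∞ φ ∧ w =ᵐ[surfaceMeasure n] conjGradient φ}

theorem continuous_polyField (u : Fin (n + 1) → Poly n) : Continuous (polyField u) :=
  (contMDiff_polyField u).continuous

theorem continuous_conjGradient {φ : Sph n → ℂ} (hφ : SmoothExt φ) :
    Continuous (conjGradient φ) := by
  refine (PiLp.continuous_toLp 2 _).comp (continuous_pi fun A => ?_)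
  exact Complex.continuous_conj.comp (hφ.tanD A).continuous

theorem inner_normalField {p : Poly n} {w : L2Vec n} (hw : w =ᵐ[surfaceMeasure n] normalField p)
    (v : L2Vec n) : inner ℂ w v =
      ∫ x : Sph n, evalAt (x : Ambient n) (conjPoly p) * ∑ A, coord A x * v x A
        ∂(surfaceMeasure n) := by
  rw [inner_eq_integral hw]
  refine integral_congr_ae (Filter.Eventually.of_forall fun x => ?_)
  simp only [normalField, polyField_apply, evalAt_mul, evalAt_X, map_mul, Complex.conj_ofReal,
    evalAt_conjPoly, Finset.mul_sum, coord]
  exact Finset.sum_congr rfl fun A _ => by ring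

theorem inner_conjGradient {φ : Sph n → ℂ} {w : L2Vec n}
    (hw : w =ᵐ[surfaceMeasure n] conjGradient φ) (v : L2Vec n) :
    inner ℂ w v = ∫ x, ∑ A, v x A * tanD A φ x ∂(surfaceMeasure n) := by
  rw [inner_eq_integral hw]
  simp [conjGradient, mul_comm]

theorem conjPoly_conjPoly (p : Poly n) : conjPoly (conjPoly p) = p := by
  rw [conjPoly, conjPoly, map_map,
    show (starRingEnd ℂ).comp (starRingEnd ℂ) = RingHom.id ℂ from RingHom.ext Complex.conj_conj,
    map_id]

theorem l2DivFree_eq (n : ℕ) :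
    l2DivFree n = ((Submodule.span ℂ (testFields n))ᗮ : Submodule ℂ (L2Vec n)) := by
  ext v
  have hmem : v ∈ (Submodule.span ℂ (testFields n))ᗮ ↔ ∀ w ∈ testFields n, inner ℂ w v = 0 := by
    rw [Submodule.mem_orthogonal]
    refine ⟨fun h w hw => h w (Submodule.subset_span hw), fun h w hw => ?_⟩
    induction hw using Submodule.span_induction with
    | mem w hw => exact h w hw
    | zero => exact inner_zero_left _
    | add w₁ w₂ _ _ h₁ h₂ => rw [inner_add_left, h₁, h₂, add_zero]
    | smul c w _ hw => rw [inner_smul_left, hw, mul_zero]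
  rw [SetLike.mem_coe, hmem]
  constructor
  · rintro ⟨h1, h2⟩ w (⟨p, hw⟩ | ⟨φ, hφ, hw⟩)
    · rw [inner_normalField hw]
      rw [integral_eq_zero_of_ae]
      filter_upwards [h1] with x hx
      rw [hx, mul_zero, Pi.zero_apply]
    · rw [inner_conjGradient hw, h2 φ hφ]
  · intro h
    constructor
    · refine ae_eq_zero_of_orthogonal_harmPoly ?_ fun k p _ => ?_
      · exact integrable_finsetSum _ fun A _ =>
          integrable_mul_coe_apply (smoothExt_coord A).continuous v A
      · have hw := (memLp_of_continuous (continuous_polyField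
          fun A => X A * conjPoly p)).coeFn_toLp
        have h1 := inner_normalField (p := conjPoly p) hw v
        rw [h _ (Or.inl ⟨_, hw⟩), conjPoly_conjPoly] at h1
        exact h1.symm
    · intro φ hφ
      have hw := (memLp_of_continuous
        (continuous_conjGradient (smoothExt_of_contMDiff hφ))).coeFn_toLp
      rw [← inner_conjGradient hw, h _ (Or.inr ⟨φ, hφ, hw⟩)]

/-- Harmonic vectors are weakly divergence free. -/
theorem integral_tangHarm_mul_tanD {k : ℕ} {u : Fin (n + 1) → Poly n} (hu : u ∈ tangHarm n k)
    {φ : Sph n → ℂ} (hφ : SmoothExt φ) :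
    ∫ x, ∑ A, polyField u x A * tanD A φ x ∂(surfaceMeasure n) = 0 := by
  have hV := isHarmonicVector_polyField hu
  have h1 : ∑ A, ∫ x, tanD A (fun y => polyField u y A * φ y) x ∂(surfaceMeasure n) = 0 := by
    simp only [integral_tanD ((smoothExt_evalAt (u _)).mul hφ), polyField_apply]
    rw [← Finset.mul_sum, ← integral_finsetSum _
      fun A _ => ((smoothExt_coord A).mul ((smoothExt_evalAt (u A)).mul hφ)).integrable]
    have : ∀ x : Sph n, ∑ A, coord A x * (evalAt (x : Ambient n) (u A) * φ x) = 0 := fun x => by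
      have := hV.tangent x
      simp only [polyField_apply] at this
      simp only [← mul_assoc, ← Finset.sum_mul, this, zero_mul]
    simp [this]
  simp only [polyField_apply] at h1
  rw [← integral_finsetSum _
    fun A _ => (((smoothExt_evalAt (u A)).mul hφ).tanD A).integrable] at h1
  rw [← h1]
  refine integral_congr_ae (Filter.Eventually.of_forall fun x => ?_)
  have hd := hV.divFree x
  rw [divergence_eq (fun B => smoothExt_evalAt (u B)) hV.tangent] at hd
  simp only [tanD_mul (smoothExt_evalAt (u _)) hφ, polyField_apply, Finset.sum_add_distrib,
    ← Finset.mul_sum] at hd ⊢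
  rw [hd, mul_zero, add_zero]

theorem l2VecFields_subset : l2VecFields n ⊆ l2DivFree n := by
  rintro v ⟨ℓ, -, b, hb, hv⟩
  have hu := (isAdmissible_iff.mp hb).2
  rw [hb.vecField_eq] at hv
  constructor
  · filter_upwards [hv] with x hx
    rw [hx]
    exact isTangent_polyField hu.2 x
  · intro φ hφ
    rw [← integral_tangHarm_mul_tanD hu (smoothExt_of_contMDiff hφ)]
    refine integral_congr_ae ?_
    filter_upwards [hv] with x hx
    rw [hx]

theorem contMDiff_evalAt (p : Poly n) :
    ContMDiff (𝓡 n) 𝓘(ℝ, ℂ) ∞ fun x : Sph n => evalAt (x : Ambient n) p := by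
  have := Fact.mk (@finrank_euclideanSpace_fin ℝ _ (n + 1))
  exact (contDiff_evalAt p).contMDiff.comp contMDiff_coe_sphere

/-- Gradients and normal fields are orthogonal to tangent divergence-free fields. -/
theorem integral_gradient_add_radial {v : L2Vec n} (hv : v ∈ l2DivFree n) (S h g : Poly n) :
    ∫ x : Sph n, ∑ A, evalAt (x : Ambient n) (pderiv A S + X A * h + rsq n * pderiv A g) * v x A
      ∂(surfaceMeasure n) = 0 := by
  rw [← hv.2 _ (contMDiff_evalAt (S + g))]
  refine integral_congr_ae ?_
  filter_upwards [hv.1] with x hx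
  have e : ∀ A, evalAt (x : Ambient n) (pderiv A S + X A * h + rsq n * pderiv A g) * v x A =
      v x A * tanD A (fun y => evalAt (y : Ambient n) (S + g)) x +
        (evalAt (x : Ambient n) (h + euler (S + g))) * (coord A x * v x A) := fun A => by
    rw [tanD_evalAt]
    simp only [evalAt_add, evalAt_mul, evalAt_rsq, evalAt_sub, evalAt_X, map_add, coord]
    ring
  simp only [e, Finset.sum_add_distrib, ← Finset.mul_sum, hx, mul_zero, add_zero]

theorem conjPoly_mem_tangHarm {k : ℕ} {u : Fin (n + 1) → Poly n} (hu : u ∈ tangHarm n k) :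
    (fun B => conjPoly (u B)) ∈ tangHarm n k := by
  refine ⟨fun B => conjPoly_mem_harmPoly (hu.1 B), ?_⟩
  have h := congrArg conjPoly hu.2
  simpa [conjPoly] using h

/-- Such a field is orthogonal to all harmonic polynomial fields, by `exists_tangHarm_decomposition`;
the scalar completeness theorem then applies to each component. -/
theorem eq_zero_of_orthogonal_l2VecFields (hn : 2 ≤ n) {v : L2Vec n} (hv : v ∈ l2DivFree n)
    (h : ∀ w ∈ l2VecFields n, inner ℂ w v = 0) : v = 0 := by
  have h1 : ∀ k, ∀ u : Fin (n + 1) → Poly n, (∀ B, u B ∈ harmPoly n k) →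
      ∫ x : Sph n, ∑ A, evalAt (x : Ambient n) (u A) * v x A ∂(surfaceMeasure n) = 0 := by
    intro k u hu
    match k with
    | 0 =>
      -- A constant field is the gradient of a linear function.
      have h2 := integral_gradient_add_radial hv (∑ B, X B * u B) 0 0
      have h3 : ∀ A B, pderiv A (u B) = 0 := fun A B => by
        have h4 : (u B).IsHomogeneous 0 := (hu B).1
        rw [← totalDegree_zero_iff_isHomogeneous, totalDegree_eq_zero_iff_eq_C] at h4
        rw [h4, pderiv_C]
      have h5 : ∀ A, pderiv A (∑ B, X B * u B) = u A := fun A => by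
        simp [Derivation.leibniz, h3, pderiv_X, Pi.single_apply]
      simpa [h5] using h2
    | k + 1 =>
      obtain ⟨w, hw, S, p, g, hd⟩ := exists_tangHarm_decomposition hn hu
      have h2 := integral_gradient_add_radial hv S p g
      obtain ⟨b, hb, hbw⟩ := exists_isAdmissible (conjPoly_mem_tangHarm hw)
      have hL := (memLp_of_continuous (continuous_polyField fun B => conjPoly (w B))).coeFn_toLp
      have h3 := h _ ⟨k + 1, by omega, b, hb, by rw [hb.vecField_eq, hbw]; exact hL⟩
      rw [inner_eq_integral hL] at h3
      simp only [polyField_apply, evalAt_conjPoly, Complex.conj_conj] at h3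
      simp only [hd]
      rw [← add_zero (0 : ℂ)]
      nth_rewrite 1 [← h3]
      rw [← h2, ← integral_add]
      · refine integral_congr_ae (Filter.Eventually.of_forall fun x => ?_)
        simp only [evalAt_add, add_mul, Finset.sum_add_distrib]
      · exact integrable_finsetSum _ fun A _ =>
          integrable_mul_coe_apply (smoothExt_evalAt _).continuous v A
      · exact integrable_finsetSum _ fun A _ =>
          integrable_mul_coe_apply (smoothExt_evalAt _).continuous v A
  have h2 : ∀ A, ∀ᵐ x ∂(surfaceMeasure n), v x A = 0 := fun A => by
    refine ae_eq_zero_of_orthogonal_harmPoly (integrable_coe_apply v A) fun k p hp => ?_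
    have h3 := h1 k (fun B => if B = A then p else 0) fun B => by
      by_cases hB : B = A
      · simpa [hB] using hp
      · simp [hB]
    simpa [apply_ite (evalAt _)] using h3
  rw [Lp.eq_zero_iff_ae_eq_zero]
  filter_upwards [ae_all_iff.mpr h2] with x hx
  ext A
  exact hx A

theorem topologicalClosure_span_l2VecFields (hn : 2 ≤ n) :
    ((Submodule.span ℂ (l2VecFields n)).topologicalClosure : Set (L2Vec n)) = l2DivFree n := by
  rw [l2DivFree_eq]
  set D := (Submodule.span ℂ (testFields n))ᗮ
  set K := (Submodule.span ℂ (l2VecFields n)).topologicalClosure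
  have hKD : K ≤ D := by
    refine Submodule.topologicalClosure_minimal _ ?_ (Submodule.isClosed_orthogonal _)
    rw [Submodule.span_le, ← l2DivFree_eq]
    exact l2VecFields_subset
  have : CompleteSpace K := (Submodule.isClosed_topologicalClosure _).completeSpace_coe
  have h1 : Kᗮ ⊓ D = ⊥ := by
    rw [Submodule.eq_bot_iff]
    rintro v ⟨hv1, hv2⟩
    refine eq_zero_of_orthogonal_l2VecFields hn (by rw [l2DivFree_eq]; exact hv2) fun w hw => ?_
    exact hv1 w (Submodule.le_topologicalClosure _ (Submodule.subset_span hw))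
  have h2 := Submodule.sup_orthogonal_inf_of_hasOrthogonalProjection hKD
  rw [h1, sup_bot_eq] at h2
  rw [h2]

end HarmonicVectors

end

theorem mainTheorem8 (n : ℕ) (hn : 2 ≤ n) :
    -- characterisation of the harmonic vectors
    (∀ ℓ : ℕ, 1 ≤ ℓ →
      (∀ V : Sph n → Vec n, IsHarmonicVector (eigenvalue n ℓ) V ↔
        ∃! b : Tens n ℓ, IsAdmissible b ∧ V = vecField b) ∧
      (∀ b : Tens n ℓ, IsSymm b → IsTraceless b → (ℓ = 1 → ∑ i, b (fun _ => i) i = 0) →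
        (IsHarmonicVector (eigenvalue n ℓ) (vecField b) ↔ ∀ A, fullSymm b A = 0)) ∧
      (∀ b : Tens n ℓ, IsSymm b → (∀ A, fullSymm b A = 0) →
        (IsHarmonicVector (eigenvalue n ℓ) (vecField b) ↔ IsTraceless b))) ∧
    -- completeness in the space of divergence-free square integrable vector fields
    (∀ ℓ : ℕ, 1 ≤ ℓ → ∀ b : Tens n ℓ, IsAdmissible b →
      MemLp (vecField b) 2 (surfaceMeasure n)) ∧
    ((Submodule.span ℂ (l2VecFields n)).topologicalClosure : Set (L2Vec n)) = l2DivFree n ∧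
    -- orthogonality
    (∀ ℓ ℓ' : ℕ, 1 ≤ ℓ → 1 ≤ ℓ' → ℓ ≠ ℓ' → ∀ (b : Tens n ℓ) (b' : Tens n ℓ'),
      IsAdmissible b → IsAdmissible b' → innerProd (vecField b) (vecField b') = 0) ∧
    -- inner products
    (∀ ℓ : ℕ, 1 ≤ ℓ → ∀ b b' : Tens n ℓ, IsAdmissible b → IsAdmissible b' →
      innerProd (vecField b) (vecField b') = (normConst n ℓ : ℂ) * tensDot b b') ∧
    -- multiplicity
    (∀ ℓ : ℕ, 1 ≤ ℓ →
      (Module.finrank ℂ (harmonicSpace n (eigenvalue n ℓ)) : ℚ) =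
        (((n : ℚ) + 2 * ℓ - 1) * ((n : ℚ) + ℓ - 1) * ((n + ℓ - 3).factorial : ℚ)) /
          (((ℓ : ℚ) + 1) * ((ℓ - 1).factorial : ℚ) * ((n - 2).factorial : ℚ))) := by
  refine ⟨fun ℓ hℓ => ⟨isHarmonicVector_iff_existsUnique hn,
      fun b => isHarmonicVector_vecField_iff_fullSymm hℓ,
      fun b => isHarmonicVector_vecField_iff_isTraceless⟩,
    fun ℓ _ b hb => ?_, topologicalClosure_span_l2VecFields hn,
    fun ℓ ℓ' _ _ hne b b' => innerProd_vecField_of_ne hn hne,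
    fun ℓ _ b b' => innerProd_vecField, fun ℓ hℓ => ?_⟩
  · exact memLp_of_continuous hb.isHarmonicVector.smooth.continuous
  · rw [finrank_harmonicSpace hn, finrank_tangHarm hn hℓ]
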